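/- Let $\mathcal X,\mathcal Y$ be finite sets, let $p=p_{xy}$ be a probability distribution on $\mathcal X\times\mathcal Y$, and let $(x_1,y_1),(x_2,y_2),\dots$ be i.i.d. with law $p$. Logarithms are natural and rates and entropies are in nats. Let $(R_x,R_y)$ be a pair of real numbers with $R_x>H(x|y)$, $R_y>H(y|x)$ and $R_x+R_y>H(x,y)$. A randomized sequential code of rates $(R_x,R_y)$ consists of common randomness $\omega$, independent of the source and shared by both encoders and the decoder, and (given $\omega$) of encoding maps $\mathcal E^x_j:\mathcal X^j\to\{0,1\}^{b_j(R_x)}$ and $\mathcal E^y_j:\mathcal Y^j\to\{0,1\}^{b_j(R_y)}$, $j\ge 1$, with $b_j(R)=\lfloor jR/\ln 2\rfloor-\lfloor (j-1)R/\ln 2\rfloor$ (so $b_j(R)=b$ for all $j$ if $R=b\ln 2$ with $b$ an integer), and of decoding maps $\mathcal D_n$, $n\ge0$, which from the bits $(\mathcal E^x_j(x^j),\mathcal E^y_j(y^j))_{j\le n}$ produce estimates $(\hat x^n,\hat y^n)\in\mathcal X^n\times\mathcal Y^n$ of the first $n$ symbol pairs. The encoders perform sequential random binning if all the bits of $\mathcal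 E^x_j(u)$, $\mathcal E^y_j(w)$, over all $j$, $u\in\mathcal X^j$, $w\in\mathcal Y^j$ and all bit positions, are independent Bernoulli$(1/2)$ variables. The decoder is a maximum likelihood (ML) decoder if, for every $n$, $\mathcal D_n$ outputs a pair of maximal probability $\prod_{i\le n}p(x_i,y_i)$ among all pairs $(x^n,y^n)$ consistent with the received bits (whenever there is one). For integers $n,\Delta\ge0$, $\hat x^{n-\Delta}$ and $\hat y^{n-\Delta}$ denote the first $n-\Delta$ symbols of the estimates $\hat x^n,\hat y^n$ made at time $n$ (empty if $n\le\Delta$); probabilities are over the source and the common randomness. For $\rho\in[0,1]$ put $$E_{xy}(R_x,R_y,\rho)=\rho(R_x+R_y)-\log\Big[\sum_{x,y}p(x,y)^{\frac1{1+\rho}}\Big]^{1+\rho},$$ $$E_{x|y}(R_x,\rho)=\rho R_x-\log\sum_y\Big[\sum_x p(x,y)^{\frac1{1+\rho}}\Big]^{1+\rho},\qquad E_{y|x}(R_y,\rho)=\rho R_y-\log\sum_x\Big[\sum_y p(x,y)^{\frac1{1+\rho}}\Big]^{1+\rho},$$ and for $\gamma\in[0,1]$ $$E_x^{ML}(\gamma)=\sup_{\rho\in[0,1]}\big[\gamma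 E_{x|y}(R_x,\rho)+(1-\gamma)E_{xy}(R_x,R_y,\rho)\big],\qquad E_y^{ML}(\gamma)=\sup_{\rho\in[0,1]}\big[\gamma E_{y|x}(R_y,\rho)+(1-\gamma)E_{xy}(R_x,R_y,\rho)\big].$$ Define $$E_{ML,SW,x}=\min\Big\{\inf_{\gamma\in[0,1]}E_x^{ML}(\gamma),\ \inf_{\gamma\in[0,1)}\tfrac1{1-\gamma}E_y^{ML}(\gamma)\Big\},$$ $$E_{ML,SW,y}=\min\Big\{\inf_{\gamma\in[0,1)}\tfrac1{1-\gamma}E_x^{ML}(\gamma),\ \inf_{\gamma\in[0,1]}E_y^{ML}(\gamma)\Big\},$$ $$E_{ML,SW,xy}=\min\Big\{\inf_{\gamma\in[0,1]}E_x^{ML}(\gamma),\ \inf_{\gamma\in[0,1]}E_y^{ML}(\gamma)\Big\}.$$ Theorem. There is a randomized sequential code of rates $(R_x,R_y)$, with sequential random binning encoders and an ML decoder, such that: (i) for every $E<E_{ML,SW,x}$ there is a constant $K>0$ with $\Pr[\hat x^{n-\Delta}\ne x^{n-\Delta}]\le K e^{-\Delta E}$ for all integers $n,\Delta\ge0$;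 (ii) for every $E<E_{ML,SW,y}$ there is a constant $K>0$ with $\Pr[\hat y^{n-\Delta}\ne y^{n-\Delta}]\le K e^{-\Delta E}$ for all integers $n,\Delta\ge0$; (iii) for every $E<E_{ML,SW,xy}$ there is a constant $K>0$ with $\Pr[(\hat x^{n-\Delta},\hat y^{n-\Delta})\ne(x^{n-\Delta},y^{n-\Delta})]\le K e^{-\Delta E}$ for all integers $n,\Delta\ge0$. -/

import Mathlib

open MeasureTheory ProbabilityTheory

universe u v

namespace StreamingSW

noncomputable section

/-! ## Information measures of a pair of finite alphabet sources (natural logarithms) -/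

section Exponents

variable {X : Type u} {Y : Type v} [Fintype X] [Fintype Y]

/-- The joint probability `p(x, y)` as a real number. -/
def prob (p : PMF (X × Y)) (x : X) (y : Y) : ℝ := (p (x, y)).toReal

/-- The marginal probability of `x`. -/
def margX (p : PMF (X × Y)) (x : X) : ℝ := ∑ y, prob p x y

/-- The marginal probability of `y`. -/
def margY (p : PMF (X × Y)) (y : Y) : ℝ := ∑ x, prob p x y

/-- The joint entropy `H(x, y)`, in nats. -/
def jointEntropy (p : PMF (X × Y)) : ℝ := ∑ x, ∑ y, Real.negMulLog (prob p x y)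

/-- The conditional entropy `H(x | y)`, in nats (a `y` of probability zero contributes `0`). -/
def condEntropyXgivenY (p : PMF (X × Y)) : ℝ :=
  ∑ y, margY p y * ∑ x, Real.negMulLog (prob p x y / margY p y)

/-- The conditional entropy `H(y | x)`, in nats (an `x` of probability zero contributes `0`). -/
def condEntropyYgivenX (p : PMF (X × Y)) : ℝ :=
  ∑ x, margX p x * ∑ y, Real.negMulLog (prob p x y / margX p x)

/-- `E_{xy}(R_x, R_y, ρ)`. -/
def expXY (p : PMF (X × Y)) (Rx Ry ρ : ℝ) : ℝ :=
  ρ * (Rx + Ry) - Real.log ((∑ x, ∑ y, prob p x y ^ (1 / (1 + ρ))) ^ (1 + ρ))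

/-- `E_{x|y}(R_x, ρ)`. -/
def expXgivenY (p : PMF (X × Y)) (Rx ρ : ℝ) : ℝ :=
  ρ * Rx - Real.log (∑ y, (∑ x, prob p x y ^ (1 / (1 + ρ))) ^ (1 + ρ))

/-- `E_{y|x}(R_y, ρ)`. -/
def expYgivenX (p : PMF (X × Y)) (Ry ρ : ℝ) : ℝ :=
  ρ * Ry - Real.log (∑ x, (∑ y, prob p x y ^ (1 / (1 + ρ))) ^ (1 + ρ))

/-- `E_x^{ML}(R_x, R_y, γ)`, a supremum over `ρ ∈ [0, 1]`. -/
def expML_x (p : PMF (X × Y)) (Rx Ry γ : ℝ) : ℝ :=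
  ⨆ ρ : Set.Icc (0 : ℝ) 1, (γ * expXgivenY p Rx ρ + (1 - γ) * expXY p Rx Ry ρ)

/-- `E_y^{ML}(R_x, R_y, γ)`, a supremum over `ρ ∈ [0, 1]`. -/
def expML_y (p : PMF (X × Y)) (Rx Ry γ : ℝ) : ℝ :=
  ⨆ ρ : Set.Icc (0 : ℝ) 1, (γ * expYgivenX p Ry ρ + (1 - γ) * expXY p Rx Ry ρ)

/-- The exponent for errors on `x`.  In the cross term the point `γ = 1`, where the factor
`1 / (1 - γ)` is `+∞`, is left out of the infimum. -/
def exponentX (p : PMF (X × Y)) (Rx Ry : ℝ) : ℝ :=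
  min (⨅ γ : Set.Icc (0 : ℝ) 1, expML_x p Rx Ry γ)
    (⨅ γ : Set.Ico (0 : ℝ) 1, 1 / (1 - (γ : ℝ)) * expML_y p Rx Ry γ)

/-- The exponent for errors on `y`. -/
def exponentY (p : PMF (X × Y)) (Rx Ry : ℝ) : ℝ :=
  min (⨅ γ : Set.Ico (0 : ℝ) 1, 1 / (1 - (γ : ℝ)) * expML_x p Rx Ry γ)
    (⨅ γ : Set.Icc (0 : ℝ) 1, expML_y p Rx Ry γ)

/-- The exponent for joint errors. -/
def exponentJoint (p : PMF (X × Y)) (Rx Ry : ℝ) : ℝ :=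
  min (⨅ γ : Set.Icc (0 : ℝ) 1, expML_x p Rx Ry γ)
    (⨅ γ : Set.Icc (0 : ℝ) 1, expML_y p Rx Ry γ)

end Exponents

/-! ## Randomized sequential codes -/

/-- The number of bits an encoder of rate `R` nats (that is, `R / log 2` bits) per symbol has sent
after `j` symbols. -/
def totalBits (R : ℝ) (j : ℕ) : ℕ := ⌊(j : ℝ) * (R / Real.log 2)⌋₊

/-- The number of bits sent when the symbol with (zero based) index `j` arrives; if `R / log 2` is
a natural number `b`, then this is `b` at every time. -/
def newBits (R : ℝ) (j : ℕ) : ℕ := totalBits R (j + 1) - totalBits R j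

/-- The bit stream sent by an encoder of rate `R` during the first `n` time steps. -/
abbrev BitStream (R : ℝ) (n : ℕ) : Type := ∀ j : Fin n, Fin (newBits R j) → Bool

/-- A randomized sequential encoder-decoder triplet of rates `Rx`, `Ry`.  A point `ω : Ω` is the
common randomness, known to both encoders and to the decoder.  The bits sent when the symbol with
index `j` arrives are a function of the source symbols with index at most `j`; at each time `n` the
decoder estimates all of the first `n` source symbols from the two bit streams sent so far. -/
structure RandomizedCode (X : Type u) (Y : Type v) [MeasurableSpace X] [MeasurableSpace Y]
    (Rx Ry : ℝ) (Ω : Type (max u v)) [MeasurableSpace Ω] where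
  encX : Ω → ∀ j : ℕ, (Fin (j + 1) → X) → Fin (newBits Rx j) → Bool
  encY : Ω → ∀ j : ℕ, (Fin (j + 1) → Y) → Fin (newBits Ry j) → Bool
  dec : Ω → ∀ n : ℕ, BitStream Rx n → BitStream Ry n → (Fin n → X) × (Fin n → Y)
  measurable_encX : ∀ j u, Measurable fun ω => encX ω j u
  measurable_encY : ∀ j u, Measurable fun ω => encY ω j u
  measurable_dec : ∀ n a b, Measurable fun ω => dec ω n a b

namespace RandomizedCode

variable {X : Type u} {Y : Type v} [MeasurableSpace X] [MeasurableSpace Y]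
  {Rx Ry : ℝ} {Ω : Type (max u v)} [MeasurableSpace Ω]

/-- The bit stream of the `x` encoder for the source string `x` of length `n`. -/
def streamX (C : RandomizedCode X Y Rx Ry Ω) (ω : Ω) {n : ℕ} (x : Fin n → X) : BitStream Rx n :=
  fun j => C.encX ω j fun k : Fin ((j : ℕ) + 1) => x (Fin.castLE j.isLt k)

/-- The bit stream of the `y` encoder for the source string `y` of length `n`. -/
def streamY (C : RandomizedCode X Y Rx Ry Ω) (ω : Ω) {n : ℕ} (y : Fin n → Y) : BitStream Ry n :=
  fun j => C.encY ω j fun k : Fin ((j : ℕ) + 1) => y (Fin.castLE j.isLt k)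

/-- The pairs of source strings whose bit streams are `a` and `b`. -/
def candidates (C : RandomizedCode X Y Rx Ry Ω) (ω : Ω) {n : ℕ}
    (a : BitStream Rx n) (b : BitStream Ry n) : Set ((Fin n → X) × (Fin n → Y)) :=
  {z | C.streamX ω z.1 = a ∧ C.streamY ω z.2 = b}

/-- The probability of a pair of source strings under the memoryless source `p`. -/
def likelihood (p : PMF (X × Y)) {n : ℕ} (z : (Fin n → X) × (Fin n → Y)) : ℝ :=
  ∏ i, prob p (z.1 i) (z.2 i)

/-- Maximum likelihood decoding: whenever some pair of source strings is consistent with the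
received bit streams, the decoder outputs a most likely consistent pair (ties are broken
arbitrarily). -/
def IsMaximumLikelihood (C : RandomizedCode X Y Rx Ry Ω) (p : PMF (X × Y)) : Prop :=
  ∀ (ω : Ω) (n : ℕ) (a : BitStream Rx n) (b : BitStream Ry n),
    (C.candidates ω a b).Nonempty →
      C.dec ω n a b ∈ C.candidates ω a b ∧
        ∀ z ∈ C.candidates ω a b, likelihood p z ≤ likelihood p (C.dec ω n a b)

/-- The index set of all parity bits of both encoders: a time, a source prefix that ends at that
time, and the position of a bit among the bits sent at that time. -/
abbrev ParityIndex (X : Type u) (Y : Type v) (Rx Ry : ℝ) : Type (max u v) :=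
  (Σ j : ℕ, (Fin (j + 1) → X) × Fin (newBits Rx j)) ⊕
    (Σ j : ℕ, (Fin (j + 1) → Y) × Fin (newBits Ry j))

/-- The parity bit with a given index, as a random variable. -/
def parityBit (C : RandomizedCode X Y Rx Ry Ω) : ParityIndex X Y Rx Ry → Ω → Bool
  | .inl t, ω => C.encX ω t.1 t.2.1 t.2.2
  | .inr t, ω => C.encY ω t.1 t.2.1 t.2.2

/-- Sequential random binning: all parity bits, over both encoders, all times and all source
prefixes, are independent and Bernoulli(1/2). -/
def IsRandomBinning (C : RandomizedCode X Y Rx Ry Ω) (P : Measure Ω) : Prop :=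
  iIndepFun C.parityBit P ∧ ∀ t, P {ω | C.parityBit t ω = true} = 1 / 2

/-- The joint law of the common randomness and of the first `n` pairs of source symbols; these are
independent of the common randomness, and independent and distributed according to `p`. -/
def jointLaw (P : Measure Ω) (p : PMF (X × Y)) (n : ℕ) : Measure (Ω × (Fin n → X × Y)) :=
  P.prod (Measure.pi fun _ => p.toMeasure)

/-- The pair of estimates produced at time `n`. -/
def estimate (C : RandomizedCode X Y Rx Ry Ω) (n : ℕ) (w : Ω × (Fin n → X × Y)) :
    (Fin n → X) × (Fin n → Y) :=
  C.dec w.1 n (C.streamX w.1 fun i => (w.2 i).1) (C.streamY w.1 fun i => (w.2 i).2)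

/-- The probability that the estimate, at time `n`, of the first `n - Δ` symbols of `x` is wrong
(there are no such symbols if `n ≤ Δ`). -/
def errorProbX (C : RandomizedCode X Y Rx Ry Ω) (P : Measure Ω) (p : PMF (X × Y))
    (n Δ : ℕ) : ℝ :=
  (jointLaw P p n).real
    {w | ∃ i : Fin n, (i : ℕ) + Δ < n ∧ (C.estimate n w).1 i ≠ (w.2 i).1}

/-- The probability that the estimate, at time `n`, of the first `n - Δ` symbols of `y` is wrong. -/
def errorProbY (C : RandomizedCode X Y Rx Ry Ω) (P : Measure Ω) (p : PMF (X × Y))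
    (n Δ : ℕ) : ℝ :=
  (jointLaw P p n).real
    {w | ∃ i : Fin n, (i : ℕ) + Δ < n ∧ (C.estimate n w).2 i ≠ (w.2 i).2}

/-- The probability that the estimate, at time `n`, of the first `n - Δ` pairs of symbols is
wrong. -/
def errorProbJoint (C : RandomizedCode X Y Rx Ry Ω) (P : Measure Ω) (p : PMF (X × Y))
    (n Δ : ℕ) : ℝ :=
  (jointLaw P p n).real
    {w | ∃ i : Fin n, (i : ℕ) + Δ < n ∧
      ((C.estimate n w).1 i, (C.estimate n w).2 i) ≠ w.2 i}

end RandomizedCode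

end

end StreamingSW

/-! The true pair of strings is always consistent with the received bits, so a wrong ML estimate is
a consistent pair at least as likely as the truth. Sort such competitors by the positions `l` and
`k` at which their two components first depart from the source. A parity bit is indexed by a whole
prefix, so from `l` (resp. `k`) on the competitor's bits are independent of those of the source, and
a fixed competitor survives with probability at most `4 * exp (-((n - l) Rx + (n - k) Ry))`
(`measureReal_stream_eq_le`).

Gallager's union bound with parameter `ρ` (`sum_prod_mul_le_gallager`) then factorises over letters:
factor 1 before both departures, the sum in `expXgivenY` or `expYgivenX` while one component has
departed, the sum in `expXY` after both. If `l ≤ k`, this is the exponent `(n - l) * expML_x` at `γ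
= (k - l) / (n - l)`; if `k ≤ l`, symmetrically with `expML_y`.

An error on `x` at delay `Δ` forces `n - l > Δ`. If `l ≤ k`, the exponent is at least `Δ` times the
plain infimum; if `k < l`, then `n - k = (n - l) / (1 - γ)`, which produces the weight `1 / (1 -
γ)`. For a joint error the delay condition passes to the earlier departure, so no weight appears.

It remains to sum over `(l, k)` uniformly in `n`. At `ρ = 0` the Gallager exponents vanish with
slope rate minus entropy, so the ML exponents exceed some `c > 0` for all `γ`
(`exists_pos_le_expML`). The gap `E < E₀` frees a fraction of the exponent, which pays for two
geometric series (`exists_const_sum_le`). -/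

namespace StreamingSW

/-! ### Collision probability of random bit streams -/

/-- If `a` and `b` index disjoint families of fair independent bits, the two families agree with
probability at most `2 ^ (-|J|)`. -/
lemma measureReal_bits_eq_le {Ω I J : Type*} [MeasurableSpace Ω] {P : Measure Ω}
    [IsProbabilityMeasure P] [Fintype J] {f : I → Ω → Bool} (hind : iIndepFun f P)
    (hf : ∀ i, Measurable (f i)) (hhalf : ∀ i, P {ω | f i ω = true} = 1 / 2)
    (a b : J → I) (hab : Function.Injective (Sum.elim a b)) :
    P.real {ω | ∀ j, f (a j) ω = f (b j) ω} ≤ (1 / 2 : ℝ) ^ Fintype.card J := by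
  classical
  have hbit : ∀ i c, P.real (f i ⁻¹' {c}) = 1 / 2 := by
    have htrue : ∀ i, P.real (f i ⁻¹' {true}) = 1 / 2 := fun i => by
      have := hhalf i
      simp only [Measure.real]
      change (P {ω | f i ω = true}).toReal = _
      rw [this]; simp
    rintro i (_ | _)
    · have h := probReal_compl_eq_one_sub (μ := P)
        (hf i (measurableSet_singleton true) : MeasurableSet (f i ⁻¹' {true}))
      rw [htrue] at h
      have hc : (f i ⁻¹' {true})ᶜ = f i ⁻¹' {false} := by ext ω; simp
      rw [← hc, h]; norm_num
    · exact htrue i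
  have hcyl : ∀ c : J → Bool,
      P.real (⋂ i, f (Sum.elim a b i) ⁻¹' {Sum.elim c c i}) =
        (1 / 2 : ℝ) ^ (Fintype.card J + Fintype.card J) := fun c => by
    have h := (hind.precomp hab).meas_iInter
      (s := fun i => f (Sum.elim a b i) ⁻¹' {Sum.elim c c i})
      (fun i => ⟨_, measurableSet_singleton _, rfl⟩)
    rw [Measure.real, h, ENNReal.toReal_prod]
    have : ∀ i, (P (f (Sum.elim a b i) ⁻¹' {Sum.elim c c i})).toReal = 1 / 2 := fun i => hbit _ _
    simp only [this, Finset.prod_const, Finset.card_univ, Fintype.card_sum]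
  -- Union over the common bit pattern `c`: there are `2 ^ |J|` patterns, and each prescribes `2 *
  -- |J|` distinct bits.
  calc P.real {ω | ∀ j, f (a j) ω = f (b j) ω}
      ≤ P.real (⋃ c ∈ (Finset.univ : Finset (J → Bool)),
          ⋂ i, f (Sum.elim a b i) ⁻¹' {Sum.elim c c i}) := by
        refine measureReal_mono (fun ω hω => ?_) (measure_ne_top _ _)
        simp only [Finset.mem_univ, Set.iUnion_true, Set.mem_iUnion, Set.mem_iInter]
        refine ⟨fun j => f (b j) ω, ?_⟩
        rintro (j | j)
        · exact hω j
        · rfl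
    _ ≤ ∑ c : J → Bool, P.real (⋂ i, f (Sum.elim a b i) ⁻¹' {Sum.elim c c i}) :=
        measureReal_biUnion_finset_le _ _
    _ = (1 / 2 : ℝ) ^ Fintype.card J := by
        simp only [hcyl, Finset.sum_const, Finset.card_univ, Fintype.card_fun, Fintype.card_bool,
          nsmul_eq_mul, pow_add]
        push_cast
        rw [← mul_assoc, ← mul_pow]; norm_num

lemma totalBits_mono {R : ℝ} (hR : 0 ≤ R) : Monotone (totalBits R) := fun i j hij => by
  unfold totalBits
  have : 0 ≤ R / Real.log 2 := div_nonneg hR (Real.log_nonneg (by norm_num))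
  gcongr

lemma sum_newBits {R : ℝ} (hR : 0 ≤ R) {l n : ℕ} (h : l ≤ n) :
    ∑ j : {j : Fin n // l ≤ (j : ℕ)}, newBits R (j : Fin n) = totalBits R n - totalBits R l := by
  trans ∑ j ∈ Finset.Ico l n, newBits R j
  · refine Finset.sum_bij (fun j _ => ((j : Fin n) : ℕ)) ?_ ?_ ?_ ?_
    · rintro ⟨j, hj⟩ -; simp [hj]
    · rintro ⟨j, hj⟩ - ⟨k, hk⟩ - hjk; ext; exact hjk
    · intro j hj
      rw [Finset.mem_Ico] at hj
      exact ⟨⟨⟨j, hj.2⟩, hj.1⟩, Finset.mem_univ _, rfl⟩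
    · intros; rfl
  induction n, h using Nat.le_induction with
  | base => simp
  | succ n h ih =>
    have h2 := totalBits_mono hR h
    have h3 : totalBits R n ≤ totalBits R (n + 1) := totalBits_mono hR n.le_succ
    rw [Finset.sum_Ico_succ_top h, ih, newBits]
    omega

/-- Between the times `l` and `n`, at least `(n - l) R` nats minus one bit are sent. -/
lemma half_pow_totalBits_le {R : ℝ} (hR : 0 ≤ R) {l n : ℕ} (h : l ≤ n) :
    (1 / 2 : ℝ) ^ (totalBits R n - totalBits R l) ≤ 2 * Real.exp (-((n - l : ℝ) * R)) := by
  have hl2 : 0 < Real.log 2 := Real.log_pos (by norm_num)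
  have hq : 0 ≤ R / Real.log 2 := div_nonneg hR hl2.le
  have h1 : (l : ℝ) * (R / Real.log 2) ≥ totalBits R l := Nat.floor_le (by positivity)
  have h2 : (n : ℝ) * (R / Real.log 2) < totalBits R n + 1 := Nat.lt_floor_add_one _
  have h3 : (1 / 2 : ℝ) = Real.exp (-Real.log 2) := by
    rw [Real.exp_neg, Real.exp_log (by norm_num)]; norm_num
  have h4 : (2 : ℝ) = Real.exp (Real.log 2) := (Real.exp_log (by norm_num)).symm
  rw [h3, ← Real.exp_nat_mul, Nat.cast_sub (totalBits_mono hR h)]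
  conv_rhs => rw [h4]
  rw [← Real.exp_add, Real.exp_le_exp]
  have h5 : (R / Real.log 2) * Real.log 2 = R := div_mul_cancel₀ _ hl2.ne'
  nlinarith [mul_le_mul_of_nonneg_right (show (n : ℝ) * (R / Real.log 2) - 1 -
    (l : ℝ) * (R / Real.log 2) ≤ totalBits R n - totalBits R l by linarith) hl2.le]

/-- The strings `a` and `b` differ for the first time at position `l`; they are equal if `l = n`. -/
def FirstDiff {α : Type*} {n : ℕ} (l : ℕ) (a b : Fin n → α) : Prop :=
  l ≤ n ∧ (∀ i : Fin n, (i : ℕ) < l → a i = b i) ∧ ∀ h : l < n, a ⟨l, h⟩ ≠ b ⟨l, h⟩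

lemma exists_firstDiff {α : Type*} {n : ℕ} (a b : Fin n → α) : ∃ l, FirstDiff l a b := by
  classical
  have hex : ∃ l, ∀ h : l < n, a ⟨l, h⟩ ≠ b ⟨l, h⟩ := ⟨n, fun h => absurd h (lt_irrefl _)⟩
  refine ⟨Nat.find hex, Nat.find_min' hex fun h => absurd h (lt_irrefl _), fun i hi => ?_,
    Nat.find_spec hex⟩
  by_contra hne
  exact Nat.find_min hex hi fun _ => hne

lemma FirstDiff.le_of_ne {α : Type*} {n l : ℕ} {a b : Fin n → α} (h : FirstDiff l a b) {i : Fin n}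
    (hi : a i ≠ b i) : l ≤ i := by
  by_contra hlt
  exact hi (h.2.1 i (not_le.mp hlt))

namespace RandomizedCode

variable {X : Type u} {Y : Type v} {Rx Ry : ℝ}

/-- The parity bits sent for the strings `a` from time `l` on and for `b` from time `k` on. -/
def parityIndex {n : ℕ} (l k : ℕ) (a : Fin n → X) (b : Fin n → Y) :
    ((Σ j : {j : Fin n // l ≤ (j : ℕ)}, Fin (newBits Rx (j : Fin n))) ⊕
      (Σ j : {j : Fin n // k ≤ (j : ℕ)}, Fin (newBits Ry (j : Fin n)))) → ParityIndex X Y Rx Ry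
  | .inl ⟨j, t⟩ => .inl ⟨(j : Fin n), fun i => a (Fin.castLE j.1.isLt i), t⟩
  | .inr ⟨j, t⟩ => .inr ⟨(j : Fin n), fun i => b (Fin.castLE j.1.isLt i), t⟩

lemma parityIndex_injective {n : ℕ} (l k : ℕ) (a : Fin n → X) (b : Fin n → Y) :
    Function.Injective (parityIndex (Rx := Rx) (Ry := Ry) l k a b) := by
  rintro (⟨⟨⟨i, hi⟩, hi'⟩, s⟩ | ⟨⟨⟨i, hi⟩, hi'⟩, s⟩) (⟨⟨⟨j, hj⟩, hj'⟩, t⟩ | ⟨⟨⟨j, hj⟩, hj'⟩, t⟩) h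
  · obtain ⟨h1, h2⟩ := Sigma.mk.inj (Sum.inl.inj h)
    dsimp only at h1
    subst h1
    have := (Prod.mk.inj (eq_of_heq h2)).2
    simpa using this
  · exact absurd h Sum.inl_ne_inr
  · exact absurd h Sum.inr_ne_inl
  · obtain ⟨h1, h2⟩ := Sigma.mk.inj (Sum.inr.inj h)
    dsimp only at h1
    subst h1
    have := (Prod.mk.inj (eq_of_heq h2)).2
    simpa using this

/-- A bit index contains its whole source prefix. From the first difference on, the prefixes of the
two strings differ, so no bit is shared. -/
lemma parityIndex_ne {n l k : ℕ} {a a' : Fin n → X} {b b' : Fin n → Y} (ha : FirstDiff l a a')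
    (hb : FirstDiff k b b') (s t) :
    parityIndex (Rx := Rx) (Ry := Ry) l k a b s ≠ parityIndex l k a' b' t := by
  intro h
  rcases s with ⟨⟨⟨i, hi⟩, hi'⟩, s⟩ | ⟨⟨⟨i, hi⟩, hi'⟩, s⟩ <;>
    rcases t with ⟨⟨⟨j, hj⟩, hj'⟩, t⟩ | ⟨⟨⟨j, hj⟩, hj'⟩, t⟩
  · obtain ⟨h1, h2⟩ := Sigma.mk.inj (Sum.inl.inj h)
    dsimp only at h1 hi'
    subst h1
    exact ha.2.2 (hi'.trans_lt hi)
      (congrFun (Prod.mk.inj (eq_of_heq h2)).1 ⟨l, Nat.lt_succ_of_le hi'⟩)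
  · exact absurd h Sum.inl_ne_inr
  · exact absurd h Sum.inr_ne_inl
  · obtain ⟨h1, h2⟩ := Sigma.mk.inj (Sum.inr.inj h)
    dsimp only at h1 hi'
    subst h1
    exact hb.2.2 (hi'.trans_lt hi)
      (congrFun (Prod.mk.inj (eq_of_heq h2)).1 ⟨k, Nat.lt_succ_of_le hi'⟩)

variable [MeasurableSpace X] [MeasurableSpace Y] {Ω : Type (max u v)} [MeasurableSpace Ω]

lemma measurable_parityBit (C : RandomizedCode X Y Rx Ry Ω) (t : ParityIndex X Y Rx Ry) :
    Measurable (C.parityBit t) := by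
  rcases t with t | t
  · exact (measurable_pi_apply _).comp (C.measurable_encX _ _)
  · exact (measurable_pi_apply _).comp (C.measurable_encY _ _)

/-- Only the bits after the departures are compared. The constant 4 is one bit of rounding loss, a
factor 2, per encoder. -/
lemma measureReal_stream_eq_le {P : Measure Ω} [IsProbabilityMeasure P]
    {C : RandomizedCode X Y Rx Ry Ω} (hC : C.IsRandomBinning P) (hRx : 0 ≤ Rx) (hRy : 0 ≤ Ry)
    {n l k : ℕ} {a a' : Fin n → X} {b b' : Fin n → Y} (ha : FirstDiff l a a')
    (hb : FirstDiff k b b') :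
    P.real {ω | C.streamX ω a = C.streamX ω a' ∧ C.streamY ω b = C.streamY ω b'} ≤
      4 * Real.exp (-((n - l : ℝ) * Rx + (n - k : ℝ) * Ry)) := by
  have h := measureReal_bits_eq_le hC.1 C.measurable_parityBit hC.2
    (parityIndex l k a b) (parityIndex l k a' b')
    ((parityIndex_injective l k a b).sumElim (parityIndex_injective l k a' b')
      (parityIndex_ne ha hb))
  refine (measureReal_mono fun ω hω => ?_).trans (h.trans ?_)
  · rintro (⟨j, t⟩ | ⟨j, t⟩)
    · exact congrFun (congrFun hω.1 j) t
    · exact congrFun (congrFun hω.2 j) t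
  · rw [Fintype.card_sum, Fintype.card_sigma, Fintype.card_sigma]
    simp only [Fintype.card_fin]
    rw [sum_newBits hRx ha.1, sum_newBits hRy hb.1, pow_add]
    refine (mul_le_mul (half_pow_totalBits_le hRx ha.1) (half_pow_totalBits_le hRy hb.1)
      (by positivity) (by positivity)).trans_eq ?_
    rw [neg_add, Real.exp_add]; ring

end RandomizedCode

/-! ### The random binning code with ML decoding -/

section Construction

open RandomizedCode

variable (X : Type u) (Y : Type v) [Fintype X] [Fintype Y] [Nonempty X] [Nonempty Y]

variable {X Y} in
open Classical in
/-- A most likely pair of strings in `S`, if `S` is nonempty. -/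
noncomputable def mlChoice (p : PMF (X × Y)) {n : ℕ} (S : Set ((Fin n → X) × (Fin n → Y))) :
    (Fin n → X) × (Fin n → Y) :=
  if h : S.Nonempty then (S.exists_max_image (likelihood p) S.toFinite h).choose
  else Classical.arbitrary _

variable {X Y} in
lemma mlChoice_spec (p : PMF (X × Y)) {n : ℕ} {S : Set ((Fin n → X) × (Fin n → Y))}
    (h : S.Nonempty) :
    mlChoice p S ∈ S ∧ ∀ z ∈ S, likelihood p z ≤ likelihood p (mlChoice p S) := by
  rw [mlChoice, dif_pos h]
  exact (S.exists_max_image (likelihood p) S.toFinite h).choose_spec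

variable [MeasurableSpace X] [MeasurableSpace Y]

/-- The code whose common randomness consists of all the parity bits, decoded by maximum
likelihood. -/
noncomputable def binningCode (p : PMF (X × Y)) (Rx Ry : ℝ) :
    RandomizedCode X Y Rx Ry (ParityIndex X Y Rx Ry → Bool) where
  encX ω j a t := ω (.inl ⟨j, a, t⟩)
  encY ω j b t := ω (.inr ⟨j, b, t⟩)
  dec ω n a b := mlChoice p {z |
    (fun (j : Fin n) t => ω (.inl ⟨j, fun i => z.1 (Fin.castLE j.isLt i), t⟩)) = a ∧
    (fun (j : Fin n) t => ω (.inr ⟨j, fun i => z.2 (Fin.castLE j.isLt i), t⟩)) = b}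
  measurable_encX j a := by fun_prop
  measurable_encY j b := by fun_prop
  measurable_dec n a b := by
    -- The estimate depends on `ω` only through the set of consistent pairs, which lives in a finite
    -- type, so any choice from it is measurable.
    refine (Measurable.of_discrete (f := mlChoice p (n := n))).comp ?_
    refine measurable_set_iff.2 fun z => Measurable.and
      (measurableSet_setOfPred.1 (measurableSet_eq_fun ?_ measurable_const))
      (measurableSet_setOfPred.1 (measurableSet_eq_fun ?_ measurable_const)) <;> fun_prop

/-- The law of a fair bit. -/
noncomputable def fairBit : Measure Bool := (PMF.uniformOfFintype Bool).toMeasure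

noncomputable instance : IsProbabilityMeasure fairBit := by unfold fairBit; infer_instance

lemma binningCode_isRandomBinning (p : PMF (X × Y)) (Rx Ry : ℝ) :
    (binningCode X Y p Rx Ry).IsRandomBinning (Measure.infinitePi fun _ => fairBit) := by
  have hbit : (binningCode X Y p Rx Ry).parityBit = fun t ω => ω t := by
    funext t ω; rcases t with t | t <;> rfl
  rw [IsRandomBinning, hbit]
  refine ⟨iIndepFun_infinitePi (X := fun _ ω => ω) (by fun_prop), fun t => ?_⟩
  have h := congrArg (fun μ => μ {true})
    (Measure.infinitePi_map_eval (fun _ : ParityIndex X Y Rx Ry => fairBit) t)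
  rw [Measure.map_apply (by fun_prop) (measurableSet_singleton _)] at h
  refine Eq.trans h ?_
  rw [fairBit, PMF.toMeasure_apply_singleton _ _ (measurableSet_singleton _)]
  simp

lemma binningCode_isMaximumLikelihood (p : PMF (X × Y)) (Rx Ry : ℝ) :
    (binningCode X Y p Rx Ry).IsMaximumLikelihood p :=
  fun _ _ _ _ h => mlChoice_spec p h

end Construction

/-! ### Gallager's bound -/

/-- Gallager's bound: if, given the string `w`, the error probability `B w` is at most `κ` times
the number of strings in a box that are at least as likely as `w`, then the average of `B` is
bounded by a product of single letter terms. -/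
lemma sum_prod_mul_le_gallager {Z : Type*} [Fintype Z] [DecidableEq Z] {q : Z → ℝ}
    (hq : ∀ z, 0 ≤ q z) {n : ℕ} (S : Fin n → Z → Finset Z) {κ ρ : ℝ} (hκ : 0 ≤ κ) (hρ0 : 0 ≤ ρ)
    (hρ1 : ρ ≤ 1) {B : (Fin n → Z) → ℝ} (hB0 : ∀ w, 0 ≤ B w) (hB1 : ∀ w, B w ≤ 1)
    (hB : ∀ w, B w ≤ κ * ((Fintype.piFinset fun i => S i (w i)).filter
      fun z => ∏ i, q (w i) ≤ ∏ i, q (z i)).card) :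
    ∑ w, (∏ i, q (w i)) * B w ≤
      κ ^ ρ * ∏ i, ∑ z, q z ^ (1 / (1 + ρ)) * (∑ z' ∈ S i z, q z' ^ (1 / (1 + ρ))) ^ ρ := by
  set s : ℝ := 1 / (1 + ρ) with hs
  have hs0 : 0 < s := by positivity
  -- This identity is the reason for `s = 1 / (1 + ρ)`: both `q (w i)` and its competitors end up
  -- with the same power `s`.
  have hsρ : 1 - s * ρ = s := by rw [hs]; field_simp; ring
  have hpt : ∀ w : Fin n → Z, (∏ i, q (w i)) * B w ≤
      κ ^ ρ * ∏ i, (q (w i) ^ s * (∑ z' ∈ S i (w i), q z' ^ s) ^ ρ) := fun w => by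
    have hR0 : 0 ≤ κ ^ ρ * ∏ i, (q (w i) ^ s * (∑ z' ∈ S i (w i), q z' ^ s) ^ ρ) :=
      mul_nonneg (Real.rpow_nonneg hκ _) (Finset.prod_nonneg fun i _ =>
        mul_nonneg (Real.rpow_nonneg (hq _) _) (Real.rpow_nonneg
          (Finset.sum_nonneg fun z _ => Real.rpow_nonneg (hq _) _) _))
    rcases (Finset.prod_nonneg fun i _ => hq (w i) : 0 ≤ ∏ i, q (w i)).eq_or_lt with h0 | hL
    · rw [← h0, zero_mul]; exact hR0
    set L := ∏ i, q (w i) with hLdef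
    have hprod0 : ∀ z : Fin n → Z, 0 ≤ ∏ i, q (z i) := fun z => Finset.prod_nonneg fun i _ => hq _
    have hT0 : 0 ≤ ∑ z ∈ Fintype.piFinset fun i => S i (w i), (∏ i, q (z i)) ^ s :=
      Finset.sum_nonneg fun z _ => Real.rpow_nonneg (hprod0 z) _
    -- The indicator of `L ≤ ∏ q (z i)` is at most `(∏ q (z i) / L) ^ s`, and the latter factorises.
    have hcard : (((Fintype.piFinset fun i => S i (w i)).filter
        fun z => L ≤ ∏ i, q (z i)).card : ℝ) ≤
        L ^ (-s) * ∑ z ∈ Fintype.piFinset fun i => S i (w i), (∏ i, q (z i)) ^ s := by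
      rw [Finset.mul_sum, Finset.card_eq_sum_ones, Nat.cast_sum]
      refine le_trans ?_ (Finset.sum_le_sum_of_subset_of_nonneg (Finset.filter_subset
        (fun z => L ≤ ∏ i, q (z i)) _) fun z _ _ =>
          mul_nonneg (Real.rpow_nonneg hL.le _) (Real.rpow_nonneg (hprod0 z) _))
      refine Finset.sum_le_sum fun z hz => ?_
      have hz' := Real.rpow_le_rpow hL.le (Finset.mem_filter.1 hz).2 hs0.le
      calc ((1 : ℕ) : ℝ) = L ^ (-s) * L ^ s := by rw [← Real.rpow_add hL]; simp
        _ ≤ _ := mul_le_mul_of_nonneg_left hz' (Real.rpow_nonneg hL.le _)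
    have hBρ : B w ≤ B w ^ ρ := by
      rcases (hB0 w).eq_or_lt with h | h
      · rw [← h]; exact Real.rpow_nonneg le_rfl _
      · exact Real.self_le_rpow_of_le_one h.le (hB1 w) hρ1
    calc L * B w ≤ L * (κ * (L ^ (-s) *
          ∑ z ∈ Fintype.piFinset fun i => S i (w i), (∏ i, q (z i)) ^ s)) ^ ρ := by
          refine mul_le_mul_of_nonneg_left (hBρ.trans (Real.rpow_le_rpow (hB0 w) ?_ hρ0)) hL.le
          exact (hB w).trans (mul_le_mul_of_nonneg_left hcard hκ)
      _ = κ ^ ρ * (L ^ s *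
          (∑ z ∈ Fintype.piFinset fun i => S i (w i), (∏ i, q (z i)) ^ s) ^ ρ) := by
          rw [Real.mul_rpow hκ (mul_nonneg (Real.rpow_nonneg hL.le _) hT0),
            Real.mul_rpow (Real.rpow_nonneg hL.le _) hT0, ← Real.rpow_mul hL.le]
          have : L ^ s = L * L ^ (-s * ρ) := by
            nth_rewrite 2 [← Real.rpow_one L]
            rw [← Real.rpow_add hL]
            congr 1; linarith
          rw [this]; ring
      _ = _ := by
          congr 1
          rw [Finset.prod_mul_distrib, Real.finsetProd_rpow _ _ fun i _ => hq _,
            Real.finsetProd_rpow _ _ fun i _ => Finset.sum_nonneg fun z _ =>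
              Real.rpow_nonneg (hq _) _, Finset.prod_univ_sum]
          congr 2
          exact Finset.sum_congr rfl fun (z : Fin n → Z) _ =>
            (Real.finsetProd_rpow _ _ (fun i _ => hq (z i)) _).symm
  refine (Finset.sum_le_sum fun w _ => hpt w).trans_eq ?_
  rw [← Finset.mul_sum, Finset.prod_univ_sum, Fintype.piFinset_univ]

lemma prob_nonneg {X : Type u} {Y : Type v} (p : PMF (X × Y)) (x : X) (y : Y) : 0 ≤ prob p x y :=
  ENNReal.toReal_nonneg

/-! ### Single letter factors -/

section LetterBound

variable {X : Type u} {Y : Type v} [Fintype X] [Fintype Y]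

open Classical in
/-- The letters that may stand at position `i` of a competitor that agrees with the source string
in its first component before `l`, in its second component before `k`. -/
noncomputable def agreeSet (l k i : ℕ) (z : X × Y) : Finset (X × Y) :=
  Finset.univ.filter fun z' => (i < l → z.1 = z'.1) ∧ (i < k → z.2 = z'.2)

/-- The single letter factor in Gallager's bound. -/
noncomputable def letterFactor (p : PMF (X × Y)) (ρ : ℝ) (l k i : ℕ) : ℝ :=
  ∑ z : X × Y, prob p z.1 z.2 ^ (1 / (1 + ρ)) *
    (∑ z' ∈ agreeSet l k i z, prob p z'.1 z'.2 ^ (1 / (1 + ρ))) ^ ρ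

lemma sum_prob (p : PMF (X × Y)) : ∑ x, ∑ y, prob p x y = 1 := by
  have h : ∑ z, p z = 1 := by rw [← p.tsum_coe, tsum_fintype]
  rw [← Fintype.sum_prod_type' (f := fun x y => prob p x y)]
  simp only [prob]
  rw [← ENNReal.toReal_sum fun z _ => p.apply_ne_top z, h, ENNReal.toReal_one]

lemma mul_rpow_self {a ρ : ℝ} (ha : 0 ≤ a) (hρ : 0 ≤ ρ) : a * a ^ ρ = a ^ (1 + ρ) := by
  rw [Real.rpow_add_of_nonneg ha zero_le_one hρ, Real.rpow_one]

lemma letterFactor_of_lt_of_lt (p : PMF (X × Y)) {ρ : ℝ} (hρ : 0 ≤ ρ) {l k i : ℕ} (hl : i < l)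
    (hk : i < k) : letterFactor p ρ l k i = 1 := by
  classical
  have h : ∀ z : X × Y, agreeSet l k i z = {z} := fun z => by
    ext z'; simp [agreeSet, hl, hk, Prod.ext_iff, eq_comm]
  simp only [letterFactor, h, Finset.sum_singleton]
  rw [Fintype.sum_prod_type]
  refine Eq.trans ?_ (sum_prob p)
  refine Finset.sum_congr rfl fun x _ => Finset.sum_congr rfl fun y _ => ?_
  have h0 := prob_nonneg p x y
  rw [mul_rpow_self (Real.rpow_nonneg h0 _) hρ, ← Real.rpow_mul h0, one_div,
    inv_mul_cancel₀ (by positivity), Real.rpow_one]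

/-- The inner sum depends on `z` only through `y`, so summing the outer power over `x` gives `S * S
^ ρ` with the same `S`. -/
lemma letterFactor_of_le_of_lt (p : PMF (X × Y)) {ρ : ℝ} (hρ : 0 ≤ ρ) {l k i : ℕ} (hl : l ≤ i)
    (hk : i < k) :
    letterFactor p ρ l k i = ∑ y, (∑ x, prob p x y ^ (1 / (1 + ρ))) ^ (1 + ρ) := by
  classical
  have h : ∀ z : X × Y, ∑ z' ∈ agreeSet l k i z, prob p z'.1 z'.2 ^ (1 / (1 + ρ)) =
      ∑ x, prob p x z.2 ^ (1 / (1 + ρ)) := fun z => by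
    refine (Finset.sum_bij (fun x _ => (x, z.2)) ?_ ?_ ?_ ?_).symm
    · intro x _; simp [agreeSet, hl.not_gt]
    · intro x _ x' _ h; exact (Prod.mk.inj h).1
    · intro z' hz'
      simp only [agreeSet, hl.not_gt, hk, Finset.mem_filter] at hz'
      exact ⟨z'.1, Finset.mem_univ _, Prod.ext rfl (hz'.2.2 trivial)⟩
    · intros; rfl
  simp only [letterFactor, h]
  rw [Fintype.sum_prod_type, Finset.sum_comm]
  refine Finset.sum_congr rfl fun y _ => ?_
  dsimp only
  rw [← Finset.sum_mul, mul_rpow_self (Finset.sum_nonneg fun x _ =>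
    Real.rpow_nonneg (prob_nonneg p x y) _) hρ]

lemma letterFactor_of_lt_of_le (p : PMF (X × Y)) {ρ : ℝ} (hρ : 0 ≤ ρ) {l k i : ℕ} (hl : i < l)
    (hk : k ≤ i) :
    letterFactor p ρ l k i = ∑ x, (∑ y, prob p x y ^ (1 / (1 + ρ))) ^ (1 + ρ) := by
  classical
  have h : ∀ z : X × Y, ∑ z' ∈ agreeSet l k i z, prob p z'.1 z'.2 ^ (1 / (1 + ρ)) =
      ∑ y, prob p z.1 y ^ (1 / (1 + ρ)) := fun z => by
    refine (Finset.sum_bij (fun y _ => (z.1, y)) ?_ ?_ ?_ ?_).symm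
    · intro y _; simp [agreeSet, hk.not_gt]
    · intro y _ y' _ h; exact (Prod.mk.inj h).2
    · intro z' hz'
      simp only [agreeSet, hk.not_gt, hl, Finset.mem_filter] at hz'
      exact ⟨z'.2, Finset.mem_univ _, Prod.ext (hz'.2.1 trivial) rfl⟩
    · intros; rfl
  simp only [letterFactor, h]
  rw [Fintype.sum_prod_type]
  refine Finset.sum_congr rfl fun x _ => ?_
  dsimp only
  rw [← Finset.sum_mul, mul_rpow_self (Finset.sum_nonneg fun y _ =>
    Real.rpow_nonneg (prob_nonneg p x y) _) hρ]

lemma letterFactor_of_le_of_le (p : PMF (X × Y)) {ρ : ℝ} (hρ : 0 ≤ ρ) {l k i : ℕ} (hl : l ≤ i)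
    (hk : k ≤ i) :
    letterFactor p ρ l k i = (∑ x, ∑ y, prob p x y ^ (1 / (1 + ρ))) ^ (1 + ρ) := by
  classical
  have h : ∀ z : X × Y, agreeSet l k i z = Finset.univ := fun z => by
    ext z'; simp [agreeSet, hl.not_gt, hk.not_gt]
  simp only [letterFactor, h]
  rw [← Finset.sum_mul, Fintype.sum_prod_type, mul_rpow_self (Finset.sum_nonneg fun x _ =>
    Finset.sum_nonneg fun y _ => Real.rpow_nonneg (prob_nonneg p x y) _) hρ]

lemma prod_fin_of_three_blocks {f : ℕ → ℝ} {a b : ℝ} {l k n : ℕ} (hlk : l ≤ k) (hkn : k ≤ n)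
    (h1 : ∀ i < l, f i = 1) (h2 : ∀ i, l ≤ i → i < k → f i = a) (h3 : ∀ i, k ≤ i → f i = b) :
    ∏ i : Fin n, f i = a ^ (k - l) * b ^ (n - k) := by
  rw [Fin.prod_univ_eq_prod_range, ← Finset.prod_range_mul_prod_Ico f hkn,
    ← Finset.prod_range_mul_prod_Ico f hlk,
    Finset.prod_eq_one fun i hi => h1 i (Finset.mem_range.1 hi),
    Finset.prod_congr rfl fun i hi => h2 i (Finset.mem_Ico.1 hi).1 (Finset.mem_Ico.1 hi).2,
    Finset.prod_congr rfl fun i hi => h3 i (Finset.mem_Ico.1 hi).1]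
  simp

end LetterBound

/-! ### Probability of a competitor with given departure positions -/

namespace RandomizedCode

variable {X : Type u} {Y : Type v} [Fintype X] [Fintype Y]
  [MeasurableSpace X] [MeasurableSpace Y]
  {Rx Ry : ℝ} {Ω : Type (max u v)} [MeasurableSpace Ω]

/-- Some pair of strings that differs from the source pair first at `l` and `k`, respectively, has
the same bit streams as the source pair and is at least as likely. -/
def competitorEvent (C : RandomizedCode X Y Rx Ry Ω) (p : PMF (X × Y)) (n l k : ℕ) :
    Set (Ω × (Fin n → X × Y)) :=
  {w | ∃ z : Fin n → X × Y,
    FirstDiff l (fun i => (w.2 i).1) (fun i => (z i).1) ∧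
    FirstDiff k (fun i => (w.2 i).2) (fun i => (z i).2) ∧
    C.streamX w.1 (fun i => (w.2 i).1) = C.streamX w.1 (fun i => (z i).1) ∧
    C.streamY w.1 (fun i => (w.2 i).2) = C.streamY w.1 (fun i => (z i).2) ∧
    ∏ i, prob p (w.2 i).1 (w.2 i).2 ≤ ∏ i, prob p (z i).1 (z i).2}

instance {P : Measure Ω} [IsProbabilityMeasure P] (p : PMF (X × Y)) (n : ℕ) :
    IsProbabilityMeasure (jointLaw P p n) := by
  unfold jointLaw; infer_instance

variable [MeasurableSingletonClass X] [MeasurableSingletonClass Y]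

/-- `A` is covered by its slices over the finitely many source strings. Subadditivity and the
product formula for rectangles need no measurability of `A`. -/
lemma measureReal_jointLaw_le (P : Measure Ω) [IsProbabilityMeasure P] (p : PMF (X × Y)) (n : ℕ)
    (A : Set (Ω × (Fin n → X × Y))) :
    (jointLaw P p n).real A ≤
      ∑ w : Fin n → X × Y, (∏ i, prob p (w i).1 (w i).2) * P.real {ω | (ω, w) ∈ A} := by
  calc (jointLaw P p n).real A
      ≤ (jointLaw P p n).real (⋃ w ∈ (Finset.univ : Finset (Fin n → X × Y)),
          {ω | (ω, w) ∈ A} ×ˢ {w}) := by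
        refine measureReal_mono (fun w hw => ?_) (measure_ne_top _ _)
        simp only [Finset.mem_univ, Set.iUnion_true, Set.mem_iUnion]
        exact ⟨w.2, hw, rfl⟩
    _ ≤ ∑ w : Fin n → X × Y, (jointLaw P p n).real ({ω | (ω, w) ∈ A} ×ˢ {w}) :=
        measureReal_biUnion_finset_le _ _
    _ = _ := by
        refine Finset.sum_congr rfl fun w _ => ?_
        rw [jointLaw, measureReal_prod_prod, mul_comm]
        congr 1
        rw [Measure.real, Measure.pi_singleton, ENNReal.toReal_prod]
        refine Finset.prod_congr rfl fun i _ => ?_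
        rw [PMF.toMeasure_apply_singleton _ _ (measurableSet_singleton _)]; rfl

lemma measureReal_competitorEvent_le {P : Measure Ω} [IsProbabilityMeasure P]
    {C : RandomizedCode X Y Rx Ry Ω} (hC : C.IsRandomBinning P) (hRx : 0 ≤ Rx) (hRy : 0 ≤ Ry)
    (p : PMF (X × Y)) {ρ : ℝ} (hρ0 : 0 ≤ ρ) (hρ1 : ρ ≤ 1) (n l k : ℕ) :
    (jointLaw P p n).real (C.competitorEvent p n l k) ≤
      4 * Real.exp (-(ρ * ((n - l : ℝ) * Rx + (n - k : ℝ) * Ry))) *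
        ∏ i : Fin n, letterFactor p ρ l k i := by
  classical
  set κ : ℝ := 4 * Real.exp (-((n - l : ℝ) * Rx + (n - k : ℝ) * Ry)) with hκ
  have hκ0 : 0 ≤ κ := by positivity
  have hB : ∀ w : Fin n → X × Y, P.real {ω | (ω, w) ∈ C.competitorEvent p n l k} ≤
      κ * ((Fintype.piFinset fun i : Fin n => agreeSet l k i (w i)).filter
        fun z => ∏ i, prob p (w i).1 (w i).2 ≤ ∏ i, prob p (z i).1 (z i).2).card := fun w => by
    set T := (Finset.univ : Finset (Fin n → X × Y)).filter fun z =>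
      FirstDiff l (fun i => (w i).1) (fun i => (z i).1) ∧
      FirstDiff k (fun i => (w i).2) (fun i => (z i).2) ∧
      ∏ i, prob p (w i).1 (w i).2 ≤ ∏ i, prob p (z i).1 (z i).2 with hT
    calc P.real {ω | (ω, w) ∈ C.competitorEvent p n l k}
        ≤ P.real (⋃ z ∈ T,
            {ω | C.streamX ω (fun i => (w i).1) = C.streamX ω (fun i => (z i).1) ∧
              C.streamY ω (fun i => (w i).2) = C.streamY ω (fun i => (z i).2)}) := by
          refine measureReal_mono ?_ (measure_ne_top _ _)
          rintro ω ⟨z, h1, h2, h3, h4, h5⟩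
          simp only [Set.mem_iUnion]
          exact ⟨z, Finset.mem_filter.2 ⟨Finset.mem_univ _, h1, h2, h5⟩, h3, h4⟩
      _ ≤ ∑ z ∈ T, κ := by
          refine (measureReal_biUnion_finset_le _ _).trans (Finset.sum_le_sum fun z hz => ?_)
          obtain ⟨-, h1, h2, -⟩ := Finset.mem_filter.1 hz
          exact measureReal_stream_eq_le hC hRx hRy h1 h2
      _ = κ * T.card := by rw [Finset.sum_const, nsmul_eq_mul, mul_comm]
      _ ≤ _ := by
          refine mul_le_mul_of_nonneg_left (Nat.cast_le.2 (Finset.card_le_card fun z hz => ?_)) hκ0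
          obtain ⟨-, h1, h2, h3⟩ := Finset.mem_filter.1 hz
          refine Finset.mem_filter.2 ⟨Fintype.mem_piFinset.2 fun i => ?_, h3⟩
          exact Finset.mem_filter.2 ⟨Finset.mem_univ _, h1.2.1 i, h2.2.1 i⟩
  refine (measureReal_jointLaw_le P p n _).trans ((sum_prod_mul_le_gallager
    (q := fun z : X × Y => prob p z.1 z.2) (fun z => prob_nonneg p _ _)
    (fun (i : Fin n) => agreeSet l k i) hκ0 hρ0 hρ1 (fun w => measureReal_nonneg)
    (fun w => measureReal_le_one) hB).trans ?_)
  refine mul_le_mul_of_nonneg_right ?_ (Finset.prod_nonneg fun i _ => Finset.sum_nonneg fun z _ =>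
    mul_nonneg (Real.rpow_nonneg (prob_nonneg _ _ _) _) (Real.rpow_nonneg
      (Finset.sum_nonneg fun z _ => Real.rpow_nonneg (prob_nonneg _ _ _) _) _))
  rw [hκ, Real.mul_rpow (by norm_num) (Real.exp_pos _).le, ← Real.exp_mul]
  have h4 : (4 : ℝ) ^ ρ ≤ 4 := by
    simpa using Real.rpow_le_rpow_of_exponent_le (show (1 : ℝ) ≤ 4 by norm_num) hρ1
  refine mul_le_mul h4 (le_of_eq ?_) (Real.exp_pos _).le (by norm_num)
  congr 1; ring

end RandomizedCode

open Filter Topology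

/-! ### Gallager exponents near `ρ = 0` -/

section GallagerExponent

variable {ι κ : Type*} [Fintype ι] [Fintype κ]

/-- Gallager's function of a family of nonnegative reals in blocks. -/
noncomputable def blockSum (a : ι → κ → ℝ) (ρ : ℝ) : ℝ :=
  ∑ i, (∑ j, a i j ^ (1 / (1 + ρ))) ^ (1 + ρ)

lemma hasDerivAt_rpow_one_div {a : ℝ} (ha : 0 ≤ a) :
    HasDerivAt (fun ρ : ℝ => a ^ (1 / (1 + ρ))) (Real.negMulLog a) 0 := by
  rcases ha.eq_or_lt with rfl | ha
  · rw [Real.negMulLog_zero]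
    refine (hasDerivAt_const (0 : ℝ) (0 : ℝ)).congr_of_eventuallyEq ?_
    filter_upwards [lt_mem_nhds (show (-1 : ℝ) < 0 by norm_num)] with ρ hρ
    exact Real.zero_rpow (one_div_pos.2 (by linarith)).ne'
  · have h1 : HasDerivAt (fun ρ : ℝ => 1 + ρ) 1 0 := (hasDerivAt_id (0 : ℝ)).const_add 1
    have h2 : HasDerivAt (fun ρ : ℝ => 1 / (1 + ρ)) (-1) 0 := by
      simpa [one_div] using h1.fun_inv (by norm_num)
    have h3 := h2.const_rpow ha
    refine h3.congr_deriv ?_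
    simp [Real.negMulLog]; ring

/-- With `S = ∑ a j`, the chain rule gives `∑ negMulLog (a j) + S log S`, which is `S` times the
entropy of `a / S`. A zero block is treated apart, since `rpow` is differentiated at a positive
base. -/
lemma hasDerivAt_sum_rpow_rpow {a : κ → ℝ} (ha : ∀ j, 0 ≤ a j) :
    HasDerivAt (fun ρ : ℝ => (∑ j, a j ^ (1 / (1 + ρ))) ^ (1 + ρ))
      ((∑ j, a j) * ∑ j, Real.negMulLog (a j / ∑ j, a j)) 0 := by
  set S := ∑ j, a j with hS
  have hS0 : 0 ≤ S := Finset.sum_nonneg fun j _ => ha j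
  rcases hS0.eq_or_lt with h0 | hpos
  · have hz : ∀ j, a j = 0 := fun j =>
      (Finset.sum_eq_zero_iff_of_nonneg fun j _ => ha j).1 h0.symm j (Finset.mem_univ j)
    rw [← h0, zero_mul]
    refine (hasDerivAt_const (0 : ℝ) (0 : ℝ)).congr_of_eventuallyEq ?_
    filter_upwards [lt_mem_nhds (show (-1 : ℝ) < 0 by norm_num)] with ρ hρ
    have h1 : (0 : ℝ) < 1 + ρ := by linarith
    simp [hz, Real.zero_rpow h1.ne', Real.zero_rpow (inv_pos.2 h1).ne']
  · have h1 : HasDerivAt (fun ρ : ℝ => 1 + ρ) 1 0 := (hasDerivAt_id (0 : ℝ)).const_add 1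
    have h2 : HasDerivAt (fun ρ : ℝ => ∑ j, a j ^ (1 / (1 + ρ))) (∑ j, Real.negMulLog (a j)) 0 :=
      HasDerivAt.fun_sum fun j _ => hasDerivAt_rpow_one_div (ha j)
    have hval : ∑ j, a j ^ (1 / (1 + (0 : ℝ))) = S := by simp [hS]
    have h3 := h2.rpow h1 (by rw [hval]; exact hpos)
    refine h3.congr_deriv ?_
    rw [hval]
    have h4 : ∀ j, S * Real.negMulLog (a j / S) = Real.negMulLog (a j) + a j * Real.log S := by
      intro j
      rw [div_eq_mul_inv, Real.negMulLog_mul]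
      simp only [Real.negMulLog, Real.log_inv]
      field_simp
    rw [Finset.mul_sum, Finset.sum_congr rfl fun j _ => h4 j, Finset.sum_add_distrib,
      ← Finset.sum_mul]
    simp [hS]

variable {a : ι → κ → ℝ}

lemma blockSum_zero (h1 : ∑ i, ∑ j, a i j = 1) : blockSum a 0 = 1 := by
  simp [blockSum, h1]

/-- The slope is the rate minus the conditional entropy given the block. Blocks indexed by `y`, by
`x`, or by a single point yield the three exponents. -/
lemma hasDerivAt_exponent (ha : ∀ i j, 0 ≤ a i j) (h1 : ∑ i, ∑ j, a i j = 1) (R : ℝ) :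
    HasDerivAt (fun ρ : ℝ => ρ * R - Real.log (blockSum a ρ))
      (R - ∑ i, (∑ j, a i j) * ∑ j, Real.negMulLog (a i j / ∑ j, a i j)) 0 := by
  have h2 : HasDerivAt (blockSum a)
      (∑ i, (∑ j, a i j) * ∑ j, Real.negMulLog (a i j / ∑ j, a i j)) 0 :=
    HasDerivAt.fun_sum fun i _ => hasDerivAt_sum_rpow_rpow (ha i)
  have h3 := h2.log (by rw [blockSum_zero h1]; norm_num)
  rw [blockSum_zero h1, div_one] at h3
  simpa using ((hasDerivAt_id (0 : ℝ)).mul_const R).fun_sub h3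

lemma eventually_pos_of_hasDerivAt {f : ℝ → ℝ} {d : ℝ} (hf : HasDerivAt f d 0) (h0 : f 0 = 0)
    (hd : 0 < d) : ∀ᶠ ρ in 𝓝[>] (0 : ℝ), 0 < f ρ := by
  have h := (hasDerivAt_iff_tendsto_slope.1 hf).mono_left
    (nhdsWithin_mono (0 : ℝ) fun x (hx : 0 < x) => hx.ne')
  filter_upwards [h.eventually (lt_mem_nhds hd), self_mem_nhdsWithin] with ρ hρ hρ0
  rw [slope_def_field, h0, sub_zero, sub_zero] at hρ
  exact (div_pos_iff_of_pos_right hρ0).1 hρ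

lemma eventually_exponent_pos (ha : ∀ i j, 0 ≤ a i j) (h1 : ∑ i, ∑ j, a i j = 1) {R : ℝ}
    (hR : ∑ i, (∑ j, a i j) * ∑ j, Real.negMulLog (a i j / ∑ j, a i j) < R) :
    ∀ᶠ ρ in 𝓝[>] (0 : ℝ), 0 < ρ * R - Real.log (blockSum a ρ) :=
  eventually_pos_of_hasDerivAt (hasDerivAt_exponent ha h1 R) (by simp [blockSum_zero h1])
    (sub_pos.2 hR)

/-- One positive entry already contributes itself, for every `ρ`. The resulting upper bound on the
exponents makes the real suprema over `ρ` genuine ones. -/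
lemma exists_pos_le_blockSum (ha : ∀ i j, 0 ≤ a i j) (h1 : ∑ i, ∑ j, a i j = 1) :
    ∃ b, 0 < b ∧ ∀ ρ, 0 ≤ ρ → b ≤ blockSum a ρ := by
  obtain ⟨i, -, hi⟩ := Finset.exists_ne_zero_of_sum_ne_zero (h1.trans_ne one_ne_zero)
  obtain ⟨j, -, hij⟩ := Finset.exists_ne_zero_of_sum_ne_zero hi
  refine ⟨a i j, (ha i j).lt_of_ne' hij, fun ρ hρ => ?_⟩
  have hρ1 : (0 : ℝ) < 1 + ρ := by linarith
  have hsum : ∀ i, 0 ≤ ∑ j, a i j ^ (1 / (1 + ρ)) := fun i =>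
    Finset.sum_nonneg fun j _ => Real.rpow_nonneg (ha i j) _
  calc a i j = (a i j ^ (1 / (1 + ρ))) ^ (1 + ρ) := by
        rw [← Real.rpow_mul (ha i j), one_div, inv_mul_cancel₀ hρ1.ne', Real.rpow_one]
    _ ≤ (∑ j, a i j ^ (1 / (1 + ρ))) ^ (1 + ρ) := by
        refine Real.rpow_le_rpow (Real.rpow_nonneg (ha i j) _) ?_ hρ1.le
        exact Finset.single_le_sum (f := fun j => a i j ^ (1 / (1 + ρ)))
          (fun j _ => Real.rpow_nonneg (ha i j) _) (Finset.mem_univ j)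
    _ ≤ blockSum a ρ :=
        Finset.single_le_sum (f := fun i => (∑ j, a i j ^ (1 / (1 + ρ))) ^ (1 + ρ))
          (fun i _ => Real.rpow_nonneg (hsum i) _) (Finset.mem_univ i)

lemma blockSum_pos (ha : ∀ i j, 0 ≤ a i j) (h1 : ∑ i, ∑ j, a i j = 1) {ρ : ℝ} (hρ : 0 ≤ ρ) :
    0 < blockSum a ρ := by
  obtain ⟨b, hb, h⟩ := exists_pos_le_blockSum ha h1
  exact hb.trans_le (h ρ hρ)

lemma exists_exponent_le (ha : ∀ i j, 0 ≤ a i j) (h1 : ∑ i, ∑ j, a i j = 1) (R : ℝ) :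
    ∃ M, ∀ ρ, 0 ≤ ρ → ρ ≤ 1 → ρ * R - Real.log (blockSum a ρ) ≤ M := by
  obtain ⟨b, hb, hle⟩ := exists_pos_le_blockSum ha h1
  refine ⟨|R| - Real.log b, fun ρ h0 h1 => ?_⟩
  have h2 := Real.log_le_log hb (hle ρ h0)
  have h3 : ρ * R ≤ 1 * |R| :=
    (mul_le_mul_of_nonneg_left (le_abs_self R) h0).trans
      (mul_le_mul_of_nonneg_right h1 (abs_nonneg R))
  linarith

end GallagerExponent

section Exponents

variable {X : Type u} {Y : Type v} [Fintype X] [Fintype Y] (p : PMF (X × Y))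

lemma sum_prob_swap : ∑ y, ∑ x, prob p x y = 1 := by rw [Finset.sum_comm, sum_prob]

lemma sum_prob_unit : ∑ _i : Unit, ∑ z : X × Y, prob p z.1 z.2 = 1 := by
  rw [Fintype.sum_unique, Fintype.sum_prod_type, sum_prob]

lemma blockSum_unit (ρ : ℝ) : blockSum (fun (_ : Unit) (z : X × Y) => prob p z.1 z.2) ρ =
    (∑ x, ∑ y, prob p x y ^ (1 / (1 + ρ))) ^ (1 + ρ) := by
  rw [blockSum, Fintype.sum_unique, Fintype.sum_prod_type]

lemma expXY_eq (Rx Ry ρ : ℝ) : expXY p Rx Ry ρ =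
    ρ * (Rx + Ry) - Real.log (blockSum (fun (_ : Unit) (z : X × Y) => prob p z.1 z.2) ρ) := by
  rw [blockSum_unit, expXY]

variable {p} {Rx Ry : ℝ}

lemma bddAbove_mix {f g : ℝ → ℝ} {M N γ : ℝ} (hγ : γ ∈ Set.Icc (0 : ℝ) 1)
    (hf : ∀ ρ, 0 ≤ ρ → ρ ≤ 1 → f ρ ≤ M) (hg : ∀ ρ, 0 ≤ ρ → ρ ≤ 1 → g ρ ≤ N) :
    BddAbove (Set.range fun ρ : Set.Icc (0 : ℝ) 1 => γ * f ρ + (1 - γ) * g ρ) := by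
  refine ⟨γ * M + (1 - γ) * N, ?_⟩
  rintro _ ⟨ρ, rfl⟩
  exact add_le_add (mul_le_mul_of_nonneg_left (hf _ ρ.2.1 ρ.2.2) hγ.1)
    (mul_le_mul_of_nonneg_left (hg _ ρ.2.1 ρ.2.2) (sub_nonneg.2 hγ.2))

/-- For rates in the interior of the Slepian-Wolf region, the exponents are bounded away from `0`,
uniformly in the mixing parameter. -/
lemma exists_pos_le_expML (hx : condEntropyXgivenY p < Rx) (hy : condEntropyYgivenX p < Ry)
    (hxy : jointEntropy p < Rx + Ry) :
    ∃ c, 0 < c ∧ ∀ γ ∈ Set.Icc (0 : ℝ) 1, c ≤ expML_x p Rx Ry γ ∧ c ≤ expML_y p Rx Ry γ := by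
  have e1 := eventually_exponent_pos (a := fun y x => prob p x y) (R := Rx)
    (fun y x => prob_nonneg p x y) (sum_prob_swap p) hx
  have e2 := eventually_exponent_pos (a := prob p) (R := Ry)
    (fun x y => prob_nonneg p x y) (sum_prob p) hy
  have e3 := eventually_exponent_pos (a := fun (_ : Unit) (z : X × Y) => prob p z.1 z.2)
    (R := Rx + Ry) (fun _ z => prob_nonneg p z.1 z.2) (sum_prob_unit p) (by
      have h := sum_prob_unit p
      rw [Fintype.sum_unique] at h
      rw [Fintype.sum_unique, h, one_mul, Fintype.sum_prod_type]
      simpa [jointEntropy] using hxy)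
  -- A single small `ρ` makes all three exponents positive; being independent of `γ`, it bounds
  -- every convex combination below.
  obtain ⟨ρ, ⟨⟨⟨hρ1, hρ2⟩, hρ3⟩, hρ4⟩, hρ0⟩ :=
    (((e1.and e2).and e3).and (Ioo_mem_nhdsGT (zero_lt_one' ℝ))).and self_mem_nhdsWithin |>.exists
  have hρI : ρ ∈ Set.Icc (0 : ℝ) 1 := ⟨hρ4.1.le, hρ4.2.le⟩
  rw [← expXY_eq] at hρ3
  obtain ⟨M1, hM1⟩ := exists_exponent_le (a := fun y x => prob p x y)
    (fun y x => prob_nonneg p x y) (sum_prob_swap p) Rx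
  obtain ⟨M2, hM2⟩ := exists_exponent_le (a := prob p)
    (fun x y => prob_nonneg p x y) (sum_prob p) Ry
  obtain ⟨M3, hM3⟩ := exists_exponent_le (a := fun (_ : Unit) (z : X × Y) => prob p z.1 z.2)
    (fun _ z => prob_nonneg p z.1 z.2) (sum_prob_unit p) (Rx + Ry)
  simp only [← expXY_eq] at hM3
  have key : ∀ {f g : ℝ → ℝ} {c : ℝ}, c ≤ f ρ → c ≤ g ρ → ∀ γ ∈ Set.Icc (0 : ℝ) 1,
      c ≤ γ * f ρ + (1 - γ) * g ρ := fun h1 h2 γ hγ => by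
    nlinarith [mul_le_mul_of_nonneg_left h1 hγ.1,
      mul_le_mul_of_nonneg_left h2 (sub_nonneg.2 hγ.2)]
  refine ⟨min (min (expXgivenY p Rx ρ) (expYgivenX p Ry ρ)) (expXY p Rx Ry ρ),
    lt_min (lt_min hρ1 hρ2) hρ3, fun γ hγ => ⟨?_, ?_⟩⟩
  · exact (key ((min_le_left _ _).trans (min_le_left _ _)) (min_le_right _ _) γ hγ).trans
      (le_ciSup (bddAbove_mix (f := expXgivenY p Rx) (g := expXY p Rx Ry) hγ hM1 hM3) ⟨ρ, hρI⟩)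
  · exact (key ((min_le_left _ _).trans (min_le_right _ _)) (min_le_right _ _) γ hγ).trans
      (le_ciSup (bddAbove_mix (f := expYgivenX p Ry) (g := expXY p Rx Ry) hγ hM2 hM3) ⟨ρ, hρI⟩)

end Exponents

/-! ### Summation over departure positions -/

section Summation

/-- For `μ > 0` the hypothesis says that `f ρ` is below a fixed number, hence so is the supremum,
attained or not. -/
lemma le_exp_neg_mul_iSup {μ m : ℝ} (hμ : 0 ≤ μ) (hm : 0 < m) {f : Set.Icc (0 : ℝ) 1 → ℝ}
    (h : ∀ ρ, μ ≤ 4 * Real.exp (-(m * f ρ))) : μ ≤ 4 * Real.exp (-(m * ⨆ ρ, f ρ)) := by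
  rcases hμ.eq_or_lt with rfl | hμ
  · positivity
  have key : ∀ t : ℝ, μ ≤ 4 * Real.exp (-(m * t)) ↔ t ≤ -Real.log (μ / 4) / m := fun t => by
    rw [← div_le_iff₀' (by norm_num), ← Real.log_le_iff_le_exp (by positivity), le_div_iff₀ hm]
    constructor <;> intro h <;> linarith
  have : Nonempty (Set.Icc (0 : ℝ) 1) := ⟨⟨0, by simp⟩⟩
  exact (key _).2 (ciSup_le fun ρ => (key _).1 (h ρ))

lemma sum_pow_sub_le {r : ℝ} (h0 : 0 ≤ r) (h1 : r < 1) (n : ℕ) :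
    ∑ l ∈ Finset.range (n + 1), r ^ (n - l) ≤ (1 - r)⁻¹ := by
  have h := Finset.sum_range_reflect (fun i => r ^ i) (n + 1)
  simp only [Nat.add_sub_cancel] at h
  rw [h, ← tsum_geometric_of_lt_one h0 h1]
  exact (summable_geometric_of_lt_one h0 h1).sum_le_tsum _ fun i _ => pow_nonneg h0 i

/-- A sum over pairs of positions of terms that decay exponentially both in the delay and in the
distances of the positions from the present is bounded uniformly in the present time. -/
lemma exists_const_sum_le {E₀ E c : ℝ} (hc : 0 < c) (hE₀ : 0 < E₀) (hE : E < E₀) :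
    ∃ K : ℝ, 0 < K ∧ ∀ (n Δ : ℕ) (T : Finset (ℕ × ℕ)) (a : ℕ × ℕ → ℝ),
      T ⊆ Finset.range (n + 1) ×ˢ Finset.range (n + 1) →
      (∀ t ∈ T, ∃ Q, a t ≤ 4 * Real.exp (-Q) ∧ Δ * E₀ ≤ Q ∧ (n - t.1 : ℝ) * c ≤ Q ∧
        (n - t.2 : ℝ) * c ≤ Q) → ∑ t ∈ T, a t ≤ K * Real.exp (-(Δ * E)) := by
  -- `E` may be negative. The share `1 - θ` of `Q` yields `Δ * E'`; the rest is split evenly, `θ /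
  -- 2` for each distance to `n`, whence the ratio `r`.
  set E' := max E 0 with hE'
  have hE'0 : 0 ≤ E' := le_max_right _ _
  set θ := 1 - E' / E₀ with hθ
  have hθ0 : 0 < θ := sub_pos.2 ((div_lt_one hE₀).2 (max_lt hE hE₀))
  have hθ1 : 0 ≤ 1 - θ := by rw [hθ]; simp only [sub_sub_cancel]; positivity
  have hθE : (1 - θ) * E₀ = E' := by rw [hθ]; field_simp; ring
  set r := Real.exp (-(θ * c / 2)) with hr
  have hr0 : 0 < r := Real.exp_pos _
  have hr1 : r < 1 := Real.exp_lt_one_iff.2 (by have := mul_pos hθ0 hc; linarith)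
  have hr2 : 0 < (1 - r)⁻¹ := inv_pos.2 (sub_pos.2 hr1)
  refine ⟨4 * ((1 - r)⁻¹ * (1 - r)⁻¹), by positivity, fun n Δ T a hT ha => ?_⟩
  have hterm : ∀ t ∈ T, a t ≤
      4 * Real.exp (-(Δ * E)) * (r ^ (n - t.1) * r ^ (n - t.2)) := fun t ht => by
    obtain ⟨Q, h1, h2, h3, h4⟩ := ha t ht
    have ht' := Finset.mem_product.1 (hT ht)
    have l1 : t.1 ≤ n := Nat.lt_succ_iff.1 (Finset.mem_range.1 ht'.1)
    have l2 : t.2 ≤ n := Nat.lt_succ_iff.1 (Finset.mem_range.1 ht'.2)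
    refine h1.trans ?_
    rw [mul_assoc, hr, ← Real.exp_nat_mul, ← Real.exp_nat_mul, ← Real.exp_add, ← Real.exp_add,
      Nat.cast_sub l1, Nat.cast_sub l2]
    refine mul_le_mul_of_nonneg_left (Real.exp_le_exp.2 ?_) (by norm_num)
    have h5 : (Δ : ℝ) * E ≤ Δ * E' :=
      mul_le_mul_of_nonneg_left (le_max_left _ _) (Nat.cast_nonneg _)
    have h6 := mul_le_mul_of_nonneg_left h2 hθ1
    have h7 := mul_le_mul_of_nonneg_left h3 hθ0.le
    have h8 := mul_le_mul_of_nonneg_left h4 hθ0.le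
    have h9 : (1 - θ) * (Δ * E₀) = Δ * E' := by rw [← hθE]; ring
    linarith
  have hnn : ∀ t ∈ Finset.range (n + 1) ×ˢ Finset.range (n + 1),
      0 ≤ 4 * Real.exp (-(Δ * E)) * (r ^ (n - t.1) * r ^ (n - t.2)) := fun t _ => by positivity
  calc ∑ t ∈ T, a t ≤ ∑ t ∈ T, 4 * Real.exp (-(Δ * E)) * (r ^ (n - t.1) * r ^ (n - t.2)) :=
        Finset.sum_le_sum hterm
    _ ≤ ∑ t ∈ Finset.range (n + 1) ×ˢ Finset.range (n + 1),
          4 * Real.exp (-(Δ * E)) * (r ^ (n - t.1) * r ^ (n - t.2)) :=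
        Finset.sum_le_sum_of_subset_of_nonneg hT fun t ht _ => hnn t ht
    _ = 4 * Real.exp (-(Δ * E)) * ((∑ l ∈ Finset.range (n + 1), r ^ (n - l)) *
          ∑ l ∈ Finset.range (n + 1), r ^ (n - l)) := by
        rw [← Finset.mul_sum, Finset.sum_product, Finset.sum_mul_sum]
    _ ≤ 4 * Real.exp (-(Δ * E)) * ((1 - r)⁻¹ * (1 - r)⁻¹) := by
        have hs := sum_pow_sub_le hr0.le hr1 n
        gcongr
    _ = _ := by ring

lemma le_iInf_Icc {F : ℝ → ℝ} {c : ℝ} (hF : ∀ γ ∈ Set.Icc (0 : ℝ) 1, c ≤ F γ) :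
    c ≤ ⨅ γ : Set.Icc (0 : ℝ) 1, F γ := by
  have : Nonempty (Set.Icc (0 : ℝ) 1) := ⟨⟨0, by simp⟩⟩
  exact le_ciInf fun γ => hF γ γ.2

lemma iInf_Icc_le {F : ℝ → ℝ} {c γ : ℝ} (hF : ∀ γ ∈ Set.Icc (0 : ℝ) 1, c ≤ F γ)
    (hγ : γ ∈ Set.Icc (0 : ℝ) 1) : ⨅ γ : Set.Icc (0 : ℝ) 1, F γ ≤ F γ :=
  ciInf_le (f := fun γ : Set.Icc (0 : ℝ) 1 => F γ)
    ⟨c, by rintro _ ⟨γ, rfl⟩; exact hF γ γ.2⟩ ⟨γ, hγ⟩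

lemma le_one_div_mul {F : ℝ → ℝ} {c γ : ℝ} (hc : 0 ≤ c) (hF : ∀ γ ∈ Set.Icc (0 : ℝ) 1, c ≤ F γ)
    (hγ : γ ∈ Set.Ico (0 : ℝ) 1) : c ≤ 1 / (1 - γ) * F γ := by
  have h1 : 0 < 1 - γ := sub_pos.2 hγ.2
  have h2 : 1 ≤ 1 / (1 - γ) := (one_le_div h1).2 (by linarith [hγ.1])
  have h3 := hF γ ⟨hγ.1, hγ.2.le⟩
  calc c = 1 * c := (one_mul c).symm
    _ ≤ _ := mul_le_mul h2 h3 hc (by positivity)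

lemma le_iInf_Ico {F : ℝ → ℝ} {c : ℝ} (hc : 0 ≤ c) (hF : ∀ γ ∈ Set.Icc (0 : ℝ) 1, c ≤ F γ) :
    c ≤ ⨅ γ : Set.Ico (0 : ℝ) 1, 1 / (1 - (γ : ℝ)) * F γ := by
  have : Nonempty (Set.Ico (0 : ℝ) 1) := ⟨⟨0, by simp⟩⟩
  exact le_ciInf fun γ => le_one_div_mul hc hF γ.2

lemma iInf_Ico_le {F : ℝ → ℝ} {c γ : ℝ} (hc : 0 ≤ c) (hF : ∀ γ ∈ Set.Icc (0 : ℝ) 1, c ≤ F γ)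
    (hγ : γ ∈ Set.Ico (0 : ℝ) 1) :
    ⨅ γ : Set.Ico (0 : ℝ) 1, 1 / (1 - (γ : ℝ)) * F γ ≤ 1 / (1 - γ) * F γ :=
  ciInf_le (f := fun γ : Set.Ico (0 : ℝ) 1 => 1 / (1 - (γ : ℝ)) * F γ)
    ⟨c, by rintro _ ⟨γ, rfl⟩; exact le_one_div_mul hc hF γ.2⟩ ⟨γ, hγ⟩

/-- The exponent of a pair of positions `s ≤ t`, when the delay is at most `n - s`. -/
lemma le_exponent_of_le_first {F : ℝ → ℝ} {c E₀ : ℝ} (hc : 0 < c)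
    (hF : ∀ γ ∈ Set.Icc (0 : ℝ) 1, c ≤ F γ) (hE₀ : E₀ ≤ ⨅ γ : Set.Icc (0 : ℝ) 1, F γ)
    (hE₀0 : 0 ≤ E₀) {n s t Δ : ℕ} (hst : s ≤ t) (ht : t ≤ n) (hΔ : s + Δ < n) :
    Δ * E₀ ≤ (n - s : ℝ) * F ((t - s) / (n - s)) ∧
      (n - s : ℝ) * c ≤ (n - s : ℝ) * F ((t - s) / (n - s)) ∧
      (n - t : ℝ) * c ≤ (n - s : ℝ) * F ((t - s) / (n - s)) := by
  have h1 : (s : ℝ) ≤ t := Nat.cast_le.2 hst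
  have h2 : (t : ℝ) ≤ n := Nat.cast_le.2 ht
  have h3 : (s : ℝ) + Δ < n := by exact_mod_cast hΔ
  have hΔ0 : (0 : ℝ) ≤ Δ := Nat.cast_nonneg _
  have hns : (0 : ℝ) < n - s := by linarith
  have hγ : ((t - s) / (n - s) : ℝ) ∈ Set.Icc (0 : ℝ) 1 :=
    ⟨div_nonneg (by linarith) hns.le, (div_le_one hns).2 (by linarith)⟩
  have h4 := mul_le_mul_of_nonneg_left (hF _ hγ) hns.le
  refine ⟨?_, h4, (mul_le_mul_of_nonneg_right (by linarith) hc.le).trans h4⟩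
  exact mul_le_mul (by linarith) (hE₀.trans (iInf_Icc_le hF hγ)) hE₀0 hns.le

/-- The exponent of a pair of positions `s ≤ t`, when the delay is at most `n - t`. -/
lemma le_exponent_of_le_second {F : ℝ → ℝ} {c E₀ : ℝ} (hc : 0 < c)
    (hF : ∀ γ ∈ Set.Icc (0 : ℝ) 1, c ≤ F γ)
    (hE₀ : E₀ ≤ ⨅ γ : Set.Ico (0 : ℝ) 1, 1 / (1 - (γ : ℝ)) * F γ)
    (hE₀0 : 0 ≤ E₀) {n s t Δ : ℕ} (hst : s ≤ t) (hΔ : t + Δ < n) :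
    Δ * E₀ ≤ (n - s : ℝ) * F ((t - s) / (n - s)) ∧
      (n - s : ℝ) * c ≤ (n - s : ℝ) * F ((t - s) / (n - s)) ∧
      (n - t : ℝ) * c ≤ (n - s : ℝ) * F ((t - s) / (n - s)) := by
  have h1 : (s : ℝ) ≤ t := Nat.cast_le.2 hst
  have h3 : (t : ℝ) + Δ < n := by exact_mod_cast hΔ
  have hΔ0 : (0 : ℝ) ≤ Δ := Nat.cast_nonneg _
  have hnt : (0 : ℝ) < n - t := by linarith
  have hns : (0 : ℝ) < n - s := by linarith
  have hγ : ((t - s) / (n - s) : ℝ) ∈ Set.Ico (0 : ℝ) 1 :=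
    ⟨div_nonneg (by linarith) hns.le, (div_lt_one hns).2 (by linarith)⟩
  have h4 := mul_le_mul_of_nonneg_left (hF _ ⟨hγ.1, hγ.2.le⟩) hns.le
  refine ⟨?_, h4, (mul_le_mul_of_nonneg_right (by linarith) hc.le).trans h4⟩
  -- Here `1 - γ = (n - t) / (n - s)`: measuring the exponent by the later position, which carries
  -- the delay, creates the weight `1 / (1 - γ)`.
  have h5 : (n - s : ℝ) * F ((t - s) / (n - s)) =
      (n - t : ℝ) * (1 / (1 - (t - s) / (n - s)) * F ((t - s) / (n - s))) := by
    have : (1 - (t - s) / (n - s) : ℝ) = (n - t) / (n - s) := by field_simp; ring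
    rw [this, one_div_div]
    field_simp
  rw [h5]
  exact mul_le_mul (by linarith) (hE₀.trans (iInf_Ico_le hc.le hF hγ)) hE₀0 hnt.le

end Summation

/-! ### From decoding errors to competitors and their exponents -/

namespace RandomizedCode

variable {X : Type u} {Y : Type v} [MeasurableSpace X] [MeasurableSpace Y] {Rx Ry : ℝ}
  {Ω : Type (max u v)} [MeasurableSpace Ω]
  {P : Measure Ω} [IsProbabilityMeasure P] {C : RandomizedCode X Y Rx Ry Ω} {p : PMF (X × Y)}

lemma mem_competitorEvent (hML : C.IsMaximumLikelihood p) {n l k : ℕ}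
    {w : Ω × (Fin n → X × Y)} (hl : FirstDiff l (fun i => (w.2 i).1) (C.estimate n w).1)
    (hk : FirstDiff k (fun i => (w.2 i).2) (C.estimate n w).2) : w ∈ C.competitorEvent p n l k := by
  have h := hML w.1 n (C.streamX w.1 fun i => (w.2 i).1) (C.streamY w.1 fun i => (w.2 i).2)
    ⟨(fun i => (w.2 i).1, fun i => (w.2 i).2), rfl, rfl⟩
  exact ⟨fun i => ((C.estimate n w).1 i, (C.estimate n w).2 i), hl, hk, h.1.1.symm, h.1.2.symm,
    h.2 (fun i => (w.2 i).1, fun i => (w.2 i).2) ⟨rfl, rfl⟩⟩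

/-- If errors in the set `S n Δ` force the first wrong positions `l` and `k` to satisfy
`cond n Δ l k`, and every such pair of positions contributes with an exponent of at least `Δ E₀`,
then `S n Δ` has probability of order `exp (-Δ E)` for every `E < E₀`. -/
lemma exists_const_error_le (hML : C.IsMaximumLikelihood p) {E₀ E c : ℝ} (hc : 0 < c)
    (hE₀ : 0 < E₀) (hE : E < E₀) (S : ∀ n : ℕ, ℕ → Set (Ω × (Fin n → X × Y)))
    (cond : ℕ → ℕ → ℕ → ℕ → Prop)
    (hS : ∀ n Δ, ∀ w ∈ S n Δ, ∀ l k, FirstDiff l (fun i => (w.2 i).1) (C.estimate n w).1 →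
      FirstDiff k (fun i => (w.2 i).2) (C.estimate n w).2 → cond n Δ l k)
    (hcond : ∀ n Δ l k, l ≤ n → k ≤ n → cond n Δ l k →
      ∃ Q, (jointLaw P p n).real (C.competitorEvent p n l k) ≤ 4 * Real.exp (-Q) ∧
        Δ * E₀ ≤ Q ∧ (n - l : ℝ) * c ≤ Q ∧ (n - k : ℝ) * c ≤ Q) :
    ∃ K : ℝ, 0 < K ∧ ∀ n Δ : ℕ, (jointLaw P p n).real (S n Δ) ≤ K * Real.exp (-(Δ * E)) := by
  classical
  obtain ⟨K, hK, h⟩ := exists_const_sum_le hc hE₀ hE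
  refine ⟨K, hK, fun n Δ => ?_⟩
  set T := (Finset.range (n + 1) ×ˢ Finset.range (n + 1)).filter fun t => cond n Δ t.1 t.2 with hT
  refine le_trans ?_ (h n Δ T (fun t => (jointLaw P p n).real (C.competitorEvent p n t.1 t.2))
    (Finset.filter_subset _ _) fun t ht => ?_)
  · refine (measureReal_mono (fun w hw => ?_) (measure_ne_top _ _)).trans
      (measureReal_biUnion_finset_le T fun t => C.competitorEvent p n t.1 t.2)
    obtain ⟨l, hl⟩ := exists_firstDiff (fun i => (w.2 i).1) (C.estimate n w).1
    obtain ⟨k, hk⟩ := exists_firstDiff (fun i => (w.2 i).2) (C.estimate n w).2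
    simp only [Set.mem_iUnion]
    refine ⟨(l, k), ?_, mem_competitorEvent hML hl hk⟩
    simp only [hT, Finset.mem_filter, Finset.mem_product, Finset.mem_range, Nat.lt_succ_iff]
    exact ⟨⟨hl.1, hk.1⟩, hS n Δ w hw l k hl hk⟩
  · simp only [hT, Finset.mem_filter, Finset.mem_product, Finset.mem_range, Nat.lt_succ_iff] at ht
    exact hcond n Δ t.1 t.2 ht.1.1 ht.1.2 ht.2

variable [Fintype X] [Fintype Y]

/-- The rate term `(n - l) Rx + (n - k) Ry` splits as `(k - l) Rx + (n - k) (Rx + Ry)`, matching the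
blocks where only `x`, then both components, may differ. -/
lemma competitorEvent_le_of_le [MeasurableSingletonClass X] [MeasurableSingletonClass Y]
    (hC : C.IsRandomBinning P) (hRx : 0 ≤ Rx) (hRy : 0 ≤ Ry) {n l k : ℕ} (hlk : l ≤ k)
    (hkn : k ≤ n) (hln : l < n) :
    (jointLaw P p n).real (C.competitorEvent p n l k) ≤
      4 * Real.exp (-((n - l : ℝ) * expML_x p Rx Ry ((k - l) / (n - l)))) := by
  have hns : (0 : ℝ) < n - l := sub_pos.2 (Nat.cast_lt.2 hln)
  refine le_exp_neg_mul_iSup measureReal_nonneg hns ?_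
  rintro ⟨ρ, hρ0, hρ1⟩
  have ha := blockSum_pos (a := fun y x => prob p x y) (fun y x => prob_nonneg p x y)
    (sum_prob_swap p) hρ0
  have hb := blockSum_pos (a := fun (_ : Unit) (z : X × Y) => prob p z.1 z.2)
    (fun _ z => prob_nonneg p z.1 z.2) (sum_prob_unit p) hρ0
  rw [blockSum_unit] at hb
  refine (measureReal_competitorEvent_le hC hRx hRy p hρ0 hρ1 n l k).trans_eq ?_
  rw [prod_fin_of_three_blocks hlk hkn
    (fun i hi => letterFactor_of_lt_of_lt p hρ0 hi (hi.trans_le hlk))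
    (fun i hi hi' => letterFactor_of_le_of_lt p hρ0 hi hi')
    (fun i hi => letterFactor_of_le_of_le p hρ0 (hlk.trans hi) hi)]
  rw [blockSum] at ha
  simp only [expXgivenY, expXY]
  generalize ∑ y, (∑ x, prob p x y ^ (1 / (1 + ρ))) ^ (1 + ρ) = A at ha ⊢
  generalize (∑ x, ∑ y, prob p x y ^ (1 / (1 + ρ))) ^ (1 + ρ) = B at hb ⊢
  rw [← Real.exp_log (pow_pos ha (k - l)), ← Real.exp_log (pow_pos hb (n - k)), Real.log_pow,
    Real.log_pow, mul_assoc, ← Real.exp_add, ← Real.exp_add, Nat.cast_sub hlk, Nat.cast_sub hkn]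
  congr 2
  field_simp
  ring

lemma competitorEvent_le_of_ge [MeasurableSingletonClass X] [MeasurableSingletonClass Y]
    (hC : C.IsRandomBinning P) (hRx : 0 ≤ Rx) (hRy : 0 ≤ Ry) {n l k : ℕ} (hkl : k ≤ l)
    (hln : l ≤ n) (hkn : k < n) :
    (jointLaw P p n).real (C.competitorEvent p n l k) ≤
      4 * Real.exp (-((n - k : ℝ) * expML_y p Rx Ry ((l - k) / (n - k)))) := by
  have hns : (0 : ℝ) < n - k := sub_pos.2 (Nat.cast_lt.2 hkn)
  refine le_exp_neg_mul_iSup measureReal_nonneg hns ?_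
  rintro ⟨ρ, hρ0, hρ1⟩
  have ha := blockSum_pos (a := prob p) (fun x y => prob_nonneg p x y) (sum_prob p) hρ0
  have hb := blockSum_pos (a := fun (_ : Unit) (z : X × Y) => prob p z.1 z.2)
    (fun _ z => prob_nonneg p z.1 z.2) (sum_prob_unit p) hρ0
  rw [blockSum_unit] at hb
  refine (measureReal_competitorEvent_le hC hRx hRy p hρ0 hρ1 n l k).trans_eq ?_
  rw [prod_fin_of_three_blocks hkl hln
    (fun i hi => letterFactor_of_lt_of_lt p hρ0 (hi.trans_le hkl) hi)
    (fun i hi hi' => letterFactor_of_lt_of_le p hρ0 hi' hi)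
    (fun i hi => letterFactor_of_le_of_le p hρ0 hi (hkl.trans hi))]
  rw [blockSum] at ha
  simp only [expYgivenX, expXY]
  generalize ∑ x, (∑ y, prob p x y ^ (1 / (1 + ρ))) ^ (1 + ρ) = A at ha ⊢
  generalize (∑ x, ∑ y, prob p x y ^ (1 / (1 + ρ))) ^ (1 + ρ) = B at hb ⊢
  rw [← Real.exp_log (pow_pos ha (l - k)), ← Real.exp_log (pow_pos hb (n - l)), Real.log_pow,
    Real.log_pow, mul_assoc, ← Real.exp_add, ← Real.exp_add, Nat.cast_sub hkl, Nat.cast_sub hln]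
  congr 2
  field_simp
  ring

end RandomizedCode

/-! ### Nonnegativity of the rates -/

section Rates

variable {X : Type u} {Y : Type v} [Fintype X] [Fintype Y] (p : PMF (X × Y))

/-- Conditional entropies are nonnegative, hence so are the rates above them; this keeps the natural
number floor in `totalBits` from truncating. -/
lemma sum_negMulLog_div_nonneg {ι κ : Type*} [Fintype ι] [Fintype κ] {a : ι → κ → ℝ}
    (ha : ∀ i j, 0 ≤ a i j) :
    0 ≤ ∑ i, (∑ j, a i j) * ∑ j, Real.negMulLog (a i j / ∑ j, a i j) := by
  have hs : ∀ i, 0 ≤ ∑ j, a i j := fun i => Finset.sum_nonneg fun j _ => ha i j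
  refine Finset.sum_nonneg fun i _ => mul_nonneg (hs i) (Finset.sum_nonneg fun j _ => ?_)
  refine Real.negMulLog_nonneg (div_nonneg (ha i j) (hs i)) (div_le_one_of_le₀ ?_ (hs i))
  exact Finset.single_le_sum (f := fun j => a i j) (fun j _ => ha i j) (Finset.mem_univ j)

lemma condEntropyXgivenY_nonneg : 0 ≤ condEntropyXgivenY p :=
  sum_negMulLog_div_nonneg (a := fun y x => prob p x y) fun y x => prob_nonneg p x y

lemma condEntropyYgivenX_nonneg : 0 ≤ condEntropyYgivenX p :=
  sum_negMulLog_div_nonneg (a := prob p) fun x y => prob_nonneg p x y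

end Rates

end StreamingSW

/-! ### The main theorem -/

open StreamingSW RandomizedCode in
theorem mainTheorem1 {X : Type u} {Y : Type v} [Fintype X] [Fintype Y]
    [MeasurableSpace X] [MeasurableSingletonClass X]
    [MeasurableSpace Y] [MeasurableSingletonClass Y]
    (p : PMF (X × Y)) (Rx Ry : ℝ)
    (hx : StreamingSW.condEntropyXgivenY p < Rx)
    (hy : StreamingSW.condEntropyYgivenX p < Ry)
    (hxy : StreamingSW.jointEntropy p < Rx + Ry) :
    ∃ (Ω : Type (max u v)) (_ : MeasurableSpace Ω) (P : Measure Ω) (_ : IsProbabilityMeasure P)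
      (C : StreamingSW.RandomizedCode X Y Rx Ry Ω),
      C.IsRandomBinning P ∧ C.IsMaximumLikelihood p ∧
      (∀ E : ℝ, E < StreamingSW.exponentX p Rx Ry →
        ∃ K : ℝ, 0 < K ∧ ∀ n Δ : ℕ, C.errorProbX P p n Δ ≤ K * Real.exp (-(Δ * E))) ∧
      (∀ E : ℝ, E < StreamingSW.exponentY p Rx Ry →
        ∃ K : ℝ, 0 < K ∧ ∀ n Δ : ℕ, C.errorProbY P p n Δ ≤ K * Real.exp (-(Δ * E))) ∧
      (∀ E : ℝ, E < StreamingSW.exponentJoint p Rx Ry →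
        ∃ K : ℝ, 0 < K ∧ ∀ n Δ : ℕ, C.errorProbJoint P p n Δ ≤ K * Real.exp (-(Δ * E))) := by
  obtain ⟨z, -⟩ := p.support_nonempty
  have : Nonempty X := ⟨z.1⟩
  have : Nonempty Y := ⟨z.2⟩
  have hRx : 0 ≤ Rx := (condEntropyXgivenY_nonneg p).trans hx.le
  have hRy : 0 ≤ Ry := (condEntropyYgivenX_nonneg p).trans hy.le
  have hC := binningCode_isRandomBinning X Y p Rx Ry
  have hML := binningCode_isMaximumLikelihood X Y p Rx Ry
  obtain ⟨c, hc, hF⟩ := exists_pos_le_expML hx hy hxy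
  have hFx := fun γ hγ => (hF γ hγ).1
  have hFy := fun γ hγ => (hF γ hγ).2
  refine ⟨ParityIndex X Y Rx Ry → Bool, inferInstance, Measure.infinitePi fun _ => fairBit,
    inferInstance, binningCode X Y p Rx Ry, hC, hML, fun E hE => ?_, fun E hE => ?_,
    fun E hE => ?_⟩
  · have h0 : 0 < exponentX p Rx Ry :=
      hc.trans_le (le_min (le_iInf_Icc hFx) (le_iInf_Ico hc.le hFy))
    refine exists_const_error_le hML hc h0 hE _ (fun n Δ l _ => l + Δ < n) ?_ ?_
    · rintro n Δ w ⟨i, hi, hne⟩ l k hl -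
      exact (Nat.add_le_add_right (hl.le_of_ne hne.symm) Δ).trans_lt hi
    · intro n Δ l k hl hk hlΔ
      rcases le_total l k with h | h
      · obtain ⟨h1, h2, h3⟩ := le_exponent_of_le_first hc hFx (min_le_left _ _) h0.le h hk hlΔ
        exact ⟨_, competitorEvent_le_of_le hC hRx hRy h hk (by omega), h1, h2, h3⟩
      -- The `y` component departs first but the delay bounds `l`, the later position: this is the
      -- cross term.
      · obtain ⟨h1, h2, h3⟩ := le_exponent_of_le_second hc hFy (min_le_right _ _) h0.le h hlΔ
        exact ⟨_, competitorEvent_le_of_ge hC hRx hRy h hl (by omega), h1, h3, h2⟩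
  · have h0 : 0 < exponentY p Rx Ry :=
      hc.trans_le (le_min (le_iInf_Ico hc.le hFx) (le_iInf_Icc hFy))
    refine exists_const_error_le hML hc h0 hE _ (fun n Δ _ k => k + Δ < n) ?_ ?_
    · rintro n Δ w ⟨i, hi, hne⟩ l k - hk
      exact (Nat.add_le_add_right (hk.le_of_ne hne.symm) Δ).trans_lt hi
    · intro n Δ l k hl hk hkΔ
      rcases le_total l k with h | h
      · obtain ⟨h1, h2, h3⟩ := le_exponent_of_le_second hc hFx (min_le_left _ _) h0.le h hkΔ
        exact ⟨_, competitorEvent_le_of_le hC hRx hRy h hk (by omega), h1, h2, h3⟩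
      · obtain ⟨h1, h2, h3⟩ := le_exponent_of_le_first hc hFy (min_le_right _ _) h0.le h hl hkΔ
        exact ⟨_, competitorEvent_le_of_ge hC hRx hRy h hl (by omega), h1, h3, h2⟩
  · have h0 : 0 < exponentJoint p Rx Ry :=
      hc.trans_le (le_min (le_iInf_Icc hFx) (le_iInf_Icc hFy))
    refine exists_const_error_le hML hc h0 hE _ (fun n Δ l k => l + Δ < n ∨ k + Δ < n) ?_ ?_
    · rintro n Δ w ⟨i, hi, hne⟩ l k hl hk
      rw [Ne, Prod.ext_iff, not_and_or] at hne
      rcases hne with hne | hne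
      · exact .inl ((Nat.add_le_add_right (hl.le_of_ne (Ne.symm hne)) Δ).trans_lt hi)
      · exact .inr ((Nat.add_le_add_right (hk.le_of_ne (Ne.symm hne)) Δ).trans_lt hi)
    -- Whichever position meets the delay condition, the earlier one does too, so only the
    -- unweighted infima occur.
    · intro n Δ l k hl hk hΔ
      rcases le_total l k with h | h
      · obtain ⟨h1, h2, h3⟩ := le_exponent_of_le_first (Δ := Δ) hc hFx (min_le_left _ _) h0.le h hk
          (by omega)
        exact ⟨_, competitorEvent_le_of_le hC hRx hRy h hk (by omega), h1, h2, h3⟩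
      · obtain ⟨h1, h2, h3⟩ := le_exponent_of_le_first (Δ := Δ) hc hFy (min_le_right _ _) h0.le h hl
          (by omega)
        exact ⟨_, competitorEvent_le_of_ge hC hRx hRy h hl (by omega), h1, h3, h2⟩
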